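/- Setting. An environment $\nu=(f,\varepsilon)$ with $m\ge 1$ change points consists of a step function $f:[0,1]\to\mathbb{R}$, $f(x)=\mu_0+\sum_{i=1}^m\Delta_i\mathbf 1_{x\ge x_i^*}$, with $0<x_1^*<\dots<x_m^*<1$ and $0<|\Delta_i|\le 1$, and of i.i.d. noise variables $\varepsilon_t$ that are $1$-sub-Gaussian: $\mathbb{E}[\varepsilon_t]=0$ and $\mathbb{E}[e^{\lambda\varepsilon_t}]\le e^{\lambda^2/2}$ for all $\lambda\in\mathbb{R}$. Put $\vartheta_i=x_{i+1}^*-x_i^*$ for $1\le i\le m-1$, $\vartheta_0=\vartheta_m=1$, $s_i=\min(\vartheta_{i-1},\vartheta_i)$, and $$H_{\mathrm{detect}}^{(m,\nu)}=\max_{1\le i\le m}\frac{1}{s_i\Delta_i^2},\qquad H_{\mathrm{localize}}^{(m,\nu)}=\sum_{i=1}^m\frac1{\Delta_i^2}.$$ A (possibly randomized) algorithm $\pi$ adaptively queries points $x_t\in[0,1]$, observes $y_t=f(x_t)+\varepsilon_t$, stops after a random number $\mathcal T_\pi\in\{0,1,2,\dots\}\cup\{\infty\}$ of queries and, when it stops,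 returns $\hat x_1,\dots,\hat x_N\in\mathbb{R}$. It is $(\delta,\eta,N)$-correct if for every environment $\nu$ with $M\ge N$ change points $x_1^*<\dots<x_M^*$, with $\mathbb{P}_{\pi,\nu}$-probability at least $1-\delta$, it stops and there are indices $1\le i_1<\dots<i_N\le M$ with $|\hat x_l-x_{i_l}^*|\le\eta$ for all $l\in\{1,\dots,N\}$. Theorem. Let $m\ge 1$, $\delta\in(0,1/4)$, $\eta\in(0,1/8)$, let $\pi$ be a $(\delta,\eta,m)$-correct algorithm, and let $\nu$ be an environment with $m$ change points, with jumps $\Delta_i$ and spacings $s_i$. Then there exists an environment $\nu'$ with $m$ change points such that $$H_{\mathrm{detect}}^{(m,\nu)}\le H_{\mathrm{detect}}^{(m,\nu')}\le 4H_{\mathrm{detect}}^{(m,\nu)},\qquad \tfrac12 H_{\mathrm{localize}}^{(m,\nu)}\le H_{\mathrm{localize}}^{(m,\nu')}\le H_{\mathrm{localize}}^{(m,\nu)},$$ and $$\mathbb{P}_{\pi,\nu'}\left(\mathcal T_\pi\ge\tfrac14H_{\mathrm{detect}}^{(m,\nu)}\log\frac1{8\delta}+\tfrac12H_{\mathrm{localize}}^{(m,\nu)}\log\frac1{8\delta}+\tfrac12\sum_{i=1}^m\frac1{\Delta_i^2}\log_+\frac{s_i}{16\eta}\right)\ge\delta,$$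 where $\log_+ x=\max(\log x,0)$. -/

import Mathlib

open MeasureTheory ProbabilityTheory

universe u

noncomputable section

/-- An environment `(f, ε)` with `m` change points: a step function
`f(x) = μ₀ + ∑ i, Δ i * 1_{x ≥ x i}` on `[0,1]` with `0 < x 0 < ⋯ < x (m-1) < 1` and nonzero jumps of
magnitude at most `1`, and the common law of the i.i.d. centred `1`-sub-Gaussian noise variables.
Change points are indexed by `Fin m`, that is, starting from `0`. -/
structure Environment (m : ℕ) where
  baseline : ℝ
  loc : Fin m → ℝ
  jump : Fin m → ℝ
  noise : Measure ℝ
  loc_strictMono : StrictMono loc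
  loc_mem : ∀ i, loc i ∈ Set.Ioo (0 : ℝ) 1
  jump_ne_zero : ∀ i, jump i ≠ 0
  abs_jump_le_one : ∀ i, |jump i| ≤ 1
  noise_isProbabilityMeasure : IsProbabilityMeasure noise
  noise_mean : ∫ x, x ∂noise = 0
  noise_subGaussian : HasSubgaussianMGF (fun x : ℝ => x) 1 noise

namespace Environment

variable {m : ℕ}

instance (ν : Environment m) : IsProbabilityMeasure ν.noise := ν.noise_isProbabilityMeasure

/-- The step function of the environment. -/
def f (ν : Environment m) (x : ℝ) : ℝ :=
  ν.baseline + ∑ i, if ν.loc i ≤ x then ν.jump i else 0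

/-- `gap k` is `ϑ_k`: the distance between the `k`-th and the `(k+1)`-st change point (counted from
`1`) for `1 ≤ k ≤ m - 1`, with the convention `ϑ_0 = ϑ_m = 1`. -/
def gap (ν : Environment m) (k : ℕ) : ℝ :=
  if h : 0 < k ∧ k < m then ν.loc ⟨k, h.2⟩ - ν.loc ⟨k - 1, by omega⟩ else 1

/-- The local spacing of a change point: the smaller of the gaps before and after it. -/
def spacing (ν : Environment m) (i : Fin m) : ℝ :=
  min (ν.gap i) (ν.gap (i + 1))

/-- The squared energy `𝓔_i² = s_i Δ_i²`. -/
def energySq (ν : Environment m) (i : Fin m) : ℝ :=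
  ν.spacing i * ν.jump i ^ 2

/-- `H_detect`: the maximum of `1 / 𝓔_i²` over the change points. -/
def hDetect (ν : Environment m) : ℝ :=
  ⨆ i : Fin m, 1 / ν.energySq i

/-- The jumps in decreasing order of magnitude: `|Δ_(1)| ≥ |Δ_(2)| ≥ ⋯ ≥ |Δ_(m)|`. -/
def sortedJump (ν : Environment m) (l : Fin m) : ℝ :=
  ν.jump (Tuple.sort (fun i => -|ν.jump i|) l)

/-- `H_localize` for `N` change points: the sum of `1 / Δ_(l)²` over the `N` largest jumps. -/
def hLocalize (ν : Environment m) (N : ℕ) : ℝ :=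
  ∑ l : Fin m, if (l : ℕ) < N then 1 / ν.sortedJump l ^ 2 else 0

end Environment

/-- A sequential, adaptive, possibly randomized algorithm that returns `N` estimates.
The internal randomness is a seed drawn from an arbitrary probability space, independently of the
noise. With `t` observations made so far, `query t` chooses the next point of `[0,1]`, `stopRegion t` says
whether to stop now, and `decision t` gives the estimates that are returned when stopping now; all
of these depend on the seed and on the `t` past observations. -/
structure Algorithm (N : ℕ) where
  Seed : Type u
  seedMeasurableSpace : MeasurableSpace Seed
  seedLaw : Measure Seed
  seedLaw_isProbabilityMeasure : IsProbabilityMeasure seedLaw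
  query : (t : ℕ) → Seed × (Fin t → ℝ) → unitInterval
  stopRegion : (t : ℕ) → Set (Seed × (Fin t → ℝ))
  decision : (t : ℕ) → Seed × (Fin t → ℝ) → (Fin N → ℝ)
  measurable_query : ∀ t, Measurable (query t)
  measurableSet_stopRegion : ∀ t, MeasurableSet (stopRegion t)
  measurable_decision : ∀ t, Measurable (decision t)

namespace Algorithm

variable {N m : ℕ}

instance (π : Algorithm.{u} N) : MeasurableSpace π.Seed := π.seedMeasurableSpace

instance (π : Algorithm.{u} N) : IsProbabilityMeasure π.seedLaw := π.seedLaw_isProbabilityMeasure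

/-- The joint law of the seed and of the i.i.d. noise sequence; it induces the law of the
interaction of `π` with `ν`, all of whose variables are functions of the seed and the noise. -/
def prob (π : Algorithm.{u} N) (ν : Environment m) : Measure (π.Seed × (ℕ → ℝ)) :=
  π.seedLaw.prod (Measure.infinitePi fun _ : ℕ => ν.noise)

/-- The first `t` observations: each new one is the value of `f` at the queried point plus fresh
noise. (They are defined for all `t`, as if `π` never stopped.) -/
def obs (π : Algorithm.{u} N) (ν : Environment m) (ω : π.Seed × (ℕ → ℝ)) : (t : ℕ) → Fin t → ℝ
  | 0 => Fin.elim0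
  | t + 1 => Fin.snoc (α := fun _ => ℝ) (obs π ν ω t)
      (ν.f (π.query t (ω.1, obs π ν ω t)) + ω.2 t)

/-- The algorithm's stopping rule is met after `t` observations. -/
def StopsAt (π : Algorithm.{u} N) (ν : Environment m) (ω : π.Seed × (ℕ → ℝ)) (t : ℕ) : Prop :=
  (ω.1, obs π ν ω t) ∈ π.stopRegion t

/-- The sample complexity: the first time at which the stopping rule is met, `⊤` if there is none.
It is the number of evaluations of `f`. -/
def budget (π : Algorithm.{u} N) (ν : Environment m) (ω : π.Seed × (ℕ → ℝ)) : ℕ∞ :=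
  ⨅ (t : ℕ) (_ : π.StopsAt ν ω t), (t : ℕ∞)

/-- The event that `π` stops and that its estimates are within `η` of `N` distinct change points,
in increasing order. -/
def correctEvent (π : Algorithm.{u} N) (ν : Environment m) (η : ℝ) : Set (π.Seed × (ℕ → ℝ)) :=
  {ω | ∃ t : ℕ, π.budget ν ω = t ∧ ∃ i : Fin N → Fin m, StrictMono i ∧
    ∀ l, |π.decision t (ω.1, π.obs ν ω t) l - ν.loc (i l)| ≤ η}

/-- `(δ, η, N)`-correctness: for every environment with at least `N` change points, the estimates
are correct with probability at least `1 - δ`. -/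
def IsCorrect (π : Algorithm.{u} N) (δ η : ℝ) : Prop :=
  ∀ (m : ℕ), N ≤ m → ∀ ν : Environment m, 1 - δ ≤ (π.prob ν).real (π.correctEvent ν η)

end Algorithm

end

/-! Write `L = log (1 / (8δ))`, `T = ∑ Δ_i⁻² log₊ (s_i / (16η))`, and let `A` be the claimed
threshold. Suppose that in every environment comparable to `ν` the budget reaches `A` with
probability below `δ`, and let `n` be the largest integer below `A`. By correctness, `π` then
answers correctly within `n` queries, with probability at least `1 - 2δ`, in every comparable
environment with standard Gaussian noise. This forces `2 H_localize L ≤ n` and `H_detect L / 2 ≤ n`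
(for `δ < 1/8`), and `2 T ≤ n`. With weights `1/4`, `1/2`, `1/4` these sum to `A ≤ n`, a
contradiction; if `δ ≥ 1/8` then `L ≤ 0` and the third bound suffices.

All three rest on one change of measure, `Algorithm.mul_law_le_log`: if two signals differ
essentially only on a set `R`, an event can change probability only at the price of expected queries
in `R`. Disjoint sets `R` share the `n` queries. Reference signals need not be environments with `m`
change points.

Confidence (`two_mul_hLocalize_mul_log_le`): merging one change point with the next, and adding a
negligible one far away, makes the old answer wrong; so every interval between consecutive change
points must be visited.

Detection (`half_mul_hDetect_mul_log_le`): the two change points around the critical gap become a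
narrow bump, whose position can be any of many disjoint intervals; all of these must be searched
from the signal without bump.

Accuracy (`two_mul_sum_posLog_le`): each change point has about `s_i / η` distinguishable positions
in a window of its own. A Fano-type argument, averaged over all configurations, bounds the visits to
each window. -/

noncomputable section

/-! ### Law of the observations under Gaussian noise. -/

namespace Algorithm

variable {N m : ℕ}

/-- The first `t` observations when the signal is an arbitrary function `g`. -/
def obsOf (π : Algorithm.{u} N) (g : ℝ → ℝ) (ω : π.Seed × (ℕ → ℝ)) : (t : ℕ) → Fin t → ℝ
  | 0 => Fin.elim0
  | t + 1 => Fin.snoc (α := fun _ => ℝ) (obsOf π g ω t)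
      (g (π.query t (ω.1, obsOf π g ω t)) + ω.2 t)

theorem obs_eq_obsOf (π : Algorithm.{u} N) (ν : Environment m) (ω : π.Seed × (ℕ → ℝ)) (t : ℕ) :
    π.obs ν ω t = π.obsOf ν.f ω t := by
  induction t with
  | zero => rfl
  | succ t ih => rw [obs, obsOf, ih]

theorem obsOf_congr (π : Algorithm.{u} N) (g : ℝ → ℝ) (s : π.Seed) {e e' : ℕ → ℝ} {n : ℕ}
    (h : ∀ t < n, e t = e' t) : π.obsOf g (s, e) n = π.obsOf g (s, e') n := by
  induction n with
  | zero => rfl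
  | succ n ih =>
    rw [obsOf, obsOf, ih fun t ht => h t (ht.trans n.lt_succ_self)]
    simp [h n n.lt_succ_self]

theorem obsOf_take (π : Algorithm.{u} N) (g : ℝ → ℝ) (ω : π.Seed × (ℕ → ℝ)) {t n : ℕ}
    (h : t ≤ n) (i : Fin t) : π.obsOf g ω n (Fin.castLE h i) = π.obsOf g ω t i := by
  induction n, h using Nat.le_induction with
  | base => rfl
  | succ n h ih =>
    rw [obsOf, ← ih]
    exact Fin.snoc_castSucc (α := fun _ => ℝ) _ _ (Fin.castLE h i)

/-- The seed together with the first `n` observations. -/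
def history (π : Algorithm.{u} N) (g : ℝ → ℝ) (n : ℕ) (ω : π.Seed × (ℕ → ℝ)) :
    π.Seed × (Fin n → ℝ) :=
  (ω.1, π.obsOf g ω n)

/-- Appending the observation made with signal `g` and noise `q.2` to a history. -/
def extend (π : Algorithm.{u} N) (g : ℝ → ℝ) (n : ℕ) (q : (π.Seed × (Fin n → ℝ)) × ℝ) :
    π.Seed × (Fin (n + 1) → ℝ) :=
  (q.1.1, Fin.snoc (α := fun _ => ℝ) q.1.2 (g (π.query n q.1) + q.2))

theorem measurable_snoc {n : ℕ} :
    Measurable fun q : (Fin n → ℝ) × ℝ => (Fin.snoc (α := fun _ => ℝ) q.1 q.2 : Fin (n + 1) → ℝ) := by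
  refine measurable_pi_lambda _ fun i => ?_
  induction i using Fin.lastCases with
  | last => simpa using measurable_snd
  | cast i =>
    simp only [Fin.snoc_castSucc]
    exact (measurable_pi_apply i).comp measurable_fst

theorem measurable_query_comp (π : Algorithm.{u} N) {g : ℝ → ℝ} (hg : Measurable g) (n : ℕ) :
    Measurable fun h : π.Seed × (Fin n → ℝ) => g (π.query n h) :=
  hg.comp (measurable_subtype_coe.comp (π.measurable_query n))

theorem measurable_extend (π : Algorithm.{u} N) {g : ℝ → ℝ} (hg : Measurable g) (n : ℕ) :
    Measurable (π.extend g n) := by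
  refine (measurable_fst.comp measurable_fst).prodMk (measurable_snoc.comp
    ((measurable_snd.comp measurable_fst).prodMk ?_))
  exact ((π.measurable_query_comp hg n).comp measurable_fst).add measurable_snd

theorem measurable_history (π : Algorithm.{u} N) {g : ℝ → ℝ} (hg : Measurable g) (n : ℕ) :
    Measurable (π.history g n) := by
  induction n with
  | zero => exact measurable_fst.prodMk (measurable_pi_lambda _ fun i => i.elim0)
  | succ n ih =>
    exact (π.measurable_extend hg n).comp
      (ih.prodMk ((measurable_pi_apply n).comp measurable_snd))

/-- The joint law of the seed and of i.i.d. standard Gaussian noise. -/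
def gaussProb (π : Algorithm.{u} N) : Measure (π.Seed × (ℕ → ℝ)) :=
  π.seedLaw.prod (Measure.infinitePi fun _ : ℕ => gaussianReal 0 1)

instance (π : Algorithm.{u} N) : IsProbabilityMeasure π.gaussProb := by
  unfold gaussProb; infer_instance

/-- The law of the seed and the first `n` observations, for the signal `g` and standard Gaussian
noise. -/
def law (π : Algorithm.{u} N) (g : ℝ → ℝ) (n : ℕ) : Measure (π.Seed × (Fin n → ℝ)) :=
  π.gaussProb.map (π.history g n)

theorem isProbabilityMeasure_law (π : Algorithm.{u} N) {g : ℝ → ℝ} (hg : Measurable g) (n : ℕ) :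
    IsProbabilityMeasure (π.law g n) :=
  Measure.isProbabilityMeasure_map (π.measurable_history hg n).aemeasurable

theorem map_infinitePi_restrict_eval (n : ℕ) :
    (Measure.infinitePi fun _ : ℕ => gaussianReal 0 1).map
        (fun e => ((fun t : Finset.range n => e t), e n)) =
      ((Measure.infinitePi fun _ : ℕ => gaussianReal 0 1).map
        (fun e => (fun t : Finset.range n => e t))).prod (gaussianReal 0 1) := by
  have h := (iIndepFun_infinitePi (P := fun _ : ℕ => gaussianReal 0 1) (X := fun _ (ω : ℝ) => ω)
    (fun _ => measurable_id)).indepFun_finset (Finset.range n) {n} (by simp)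
    (fun i => measurable_pi_apply i)
  have hm : Measurable fun v : ({n} : Finset ℕ) → ℝ => v ⟨n, Finset.mem_singleton_self n⟩ :=
    measurable_pi_apply _
  have h' := h.comp measurable_id hm
  rw [indepFun_iff_map_prod_eq_prod_map_map] at h'
  · have e : (Measure.infinitePi fun _ : ℕ => gaussianReal 0 1).map (fun e : ℕ → ℝ => e n) =
      gaussianReal 0 1 := Measure.infinitePi_map_eval _ n
    exact h'.trans (congrArg (Measure.prod _) e)
  · exact (measurable_id.comp (measurable_pi_lambda _ fun i => measurable_pi_apply _)).aemeasurable
  · exact (hm.comp (measurable_pi_lambda _ fun i => measurable_pi_apply _)).aemeasurable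

/-- The first `n` observations depend only on the seed and on the noise before time `n`, hence are
independent of the noise at time `n`. -/
theorem map_history_prodMk (π : Algorithm.{u} N) {g : ℝ → ℝ} (hg : Measurable g) (n : ℕ) :
    π.gaussProb.map (fun ω => (π.history g n ω, ω.2 n)) = (π.law g n).prod (gaussianReal 0 1) := by
  classical
  set P := Measure.infinitePi fun _ : ℕ => gaussianReal 0 1 with hP
  set R : (ℕ → ℝ) → (Finset.range n → ℝ) := fun e t => e t with hR
  -- Noise from time `n` on is replaced by `0`, which does not affect the history.
  set ext : (Finset.range n → ℝ) → (ℕ → ℝ) := fun v t =>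
    if h : t ∈ Finset.range n then v ⟨t, h⟩ else 0 with hext
  have mR : Measurable R := measurable_pi_lambda _ fun i => measurable_pi_apply _
  have mext : Measurable ext := by
    refine measurable_pi_lambda _ fun t => ?_
    by_cases h : t ∈ Finset.range n
    · simp only [hext, h, dif_pos]
      fun_prop
    · simp only [hext, h, dif_neg, not_false_eq_true]
      fun_prop
  set G : π.Seed × (Finset.range n → ℝ) → π.Seed × (Fin n → ℝ) :=
    fun q => π.history g n (q.1, ext q.2) with hG
  have mG : Measurable G := (π.measurable_history hg n).comp
    (measurable_fst.prodMk (mext.comp measurable_snd))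
  have key : ∀ ω : π.Seed × (ℕ → ℝ), π.history g n ω = G (ω.1, R ω.2) := by
    intro ω
    refine Prod.ext rfl (π.obsOf_congr g ω.1 fun t ht => ?_)
    simp [hext, hR, ht]
  have e1 : π.law g n = (π.seedLaw.prod (P.map R)).map G := by
    rw [law, ← Measure.map_id (μ := π.seedLaw), Measure.map_prod_map _ _ measurable_id mR,
      Measure.map_map mG (by fun_prop), gaussProb]
    congr 1
    funext ω
    exact key ω
  have e2 : (fun ω : π.Seed × (ℕ → ℝ) => (π.history g n ω, ω.2 n)) =
      (Prod.map G id) ∘ (MeasurableEquiv.prodAssoc.symm) ∘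
        (Prod.map id fun e : ℕ → ℝ => (R e, e n)) := by
    funext ω
    exact Prod.ext (key ω) rfl
  have m1 : Measurable fun e : ℕ → ℝ => (R e, e n) := mR.prodMk (measurable_pi_apply n)
  rw [e2, ← Measure.map_map (mG.prodMap measurable_id)
      (MeasurableEquiv.prodAssoc.symm.measurable.comp (measurable_id.prodMap m1)),
    ← Measure.map_map MeasurableEquiv.prodAssoc.symm.measurable (measurable_id.prodMap m1),
    gaussProb, ← Measure.map_prod_map _ _ measurable_id m1, Measure.map_id,
    map_infinitePi_restrict_eval, e1]
  have e3 : Measure.map (⇑MeasurableEquiv.prodAssoc.symm)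
      (π.seedLaw.prod ((P.map R).prod (gaussianReal 0 1))) =
      (π.seedLaw.prod (P.map R)).prod (gaussianReal 0 1) := by
    rw [← Measure.prodAssoc_prod, Measure.map_map MeasurableEquiv.prodAssoc.symm.measurable
      MeasurableEquiv.prodAssoc.measurable]
    simp
  rw [e3, ← Measure.map_prod_map _ _ mG measurable_id, Measure.map_id]

theorem law_succ (π : Algorithm.{u} N) {g : ℝ → ℝ} (hg : Measurable g) (n : ℕ) :
    π.law g (n + 1) = ((π.law g n).prod (gaussianReal 0 1)).map (π.extend g n) := by
  have h : Measurable fun ω : π.Seed × (ℕ → ℝ) => (π.history g n ω, ω.2 n) :=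
    (π.measurable_history hg n).prodMk ((measurable_pi_apply n).comp measurable_snd)
  rw [← π.map_history_prodMk hg n, Measure.map_map (π.measurable_extend hg n) h]
  rfl

theorem _root_.MeasureTheory.Integrable.of_abs_le {α : Type*} [MeasurableSpace α]
    {μ : Measure α} [IsFiniteMeasure μ] {φ : α → ℝ} (hφ : Measurable φ) {C : ℝ} (hC : ∀ x, |φ x| ≤ C) : Integrable φ μ :=
  Integrable.of_bound hφ.aestronglyMeasurable C (Filter.Eventually.of_forall hC)

theorem integral_law_succ (π : Algorithm.{u} N) {g : ℝ → ℝ} (hg : Measurable g) (n : ℕ)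
    {φ : π.Seed × (Fin (n + 1) → ℝ) → ℝ} (hφ : Measurable φ) {C : ℝ} (hC : ∀ h, |φ h| ≤ C) :
    ∫ h, φ h ∂π.law g (n + 1) =
      ∫ h, ∫ y, φ (h.1, Fin.snoc (α := fun _ => ℝ) h.2 y) ∂gaussianReal (g (π.query n h)) 1
        ∂π.law g n := by
  have := π.isProbabilityMeasure_law hg n
  rw [π.law_succ hg, integral_map (π.measurable_extend hg n).aemeasurable
    hφ.aestronglyMeasurable, integral_prod]
  · congr 1
    funext h
    have e : gaussianReal (g (π.query n h)) 1 =
        (gaussianReal 0 1).map (fun z => g (π.query n h) + z) := by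
      rw [gaussianReal_map_const_add, zero_add]
    rw [e, integral_map (by fun_prop)]
    · rfl
    · exact (hφ.comp (measurable_const.prodMk
        (measurable_snoc.comp (measurable_const.prodMk measurable_id)))).aestronglyMeasurable
  · exact Integrable.of_abs_le (hφ.comp (π.measurable_extend hg n)) fun _ => hC _

end Algorithm

/-! ### Donsker-Varadhan inequality for Gaussians. -/

theorem gaussianPDFReal_eq_mul_exp (a b x : ℝ) :
    gaussianPDFReal b 1 x =
      gaussianPDFReal a 1 x * Real.exp ((b - a) * (x - a) - (b - a) ^ 2 / 2) := by
  simp only [gaussianPDFReal]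
  rw [mul_assoc (√_)⁻¹, ← Real.exp_add]
  congr 2
  simp only [NNReal.coe_one]
  ring

/-- The one-step Donsker-Varadhan inequality between two unit-variance Gaussians. -/
theorem integral_gaussianReal_le_log_integral_exp (a b : ℝ) {φ : ℝ → ℝ} (hφ : Measurable φ)
    {C : ℝ} (hC : ∀ x, |φ x| ≤ C) :
    ∫ x, φ x ∂gaussianReal a 1 ≤
      Real.log (∫ x, Real.exp (φ x) ∂gaussianReal b 1) + (a - b) ^ 2 / 2 := by
  -- The second summand is the log-density of the Gaussian at `b` relative to that at `a`; Jensen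
  -- under the latter, applied to `u`, gives the claim.
  set u : ℝ → ℝ := fun x => φ x + ((b - a) * (x - a) - (b - a) ^ 2 / 2) with hu
  have hid : Integrable (fun x : ℝ => x) (gaussianReal a 1) :=
    memLp_one_iff_integrable.mp (memLp_id_gaussianReal 1)
  have hφi : Integrable φ (gaussianReal a 1) := Integrable.of_abs_le hφ hC
  have hsub : Integrable (fun x : ℝ => x - a) (gaussianReal a 1) := hid.sub (integrable_const a)
  have hlin : Integrable (fun x : ℝ => (b - a) * (x - a) - (b - a) ^ 2 / 2) (gaussianReal a 1) :=
    (hsub.const_mul _).sub (integrable_const _)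
  have hui : Integrable u (gaussianReal a 1) := hφi.add hlin
  have hue : Integrable (fun x => Real.exp (u x)) (gaussianReal a 1) := by
    have h1 : Integrable (fun x => Real.exp ((b - a) * x)) (gaussianReal a 1) :=
      integrable_exp_mul_gaussianReal (b - a)
    have h2 : Integrable (fun x => Real.exp (φ x - (b - a) * a - (b - a) ^ 2 / 2) *
        Real.exp ((b - a) * x)) (gaussianReal a 1) := by
      refine h1.bdd_mul (c := Real.exp (C - (b - a) * a - (b - a) ^ 2 / 2)) ?_ ?_
      · exact (by fun_prop : Measurable _).aestronglyMeasurable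
      · refine Filter.Eventually.of_forall fun x => ?_
        rw [Real.norm_eq_abs, Real.abs_exp]
        exact Real.exp_le_exp.2 (by linarith [(abs_le.1 (hC x)).2])
    refine h2.congr (Filter.Eventually.of_forall fun x => ?_)
    simp only [hu]
    rw [← Real.exp_add]
    congr 1
    ring
  have hint : ∫ x, u x ∂gaussianReal a 1 = ∫ x, φ x ∂gaussianReal a 1 - (b - a) ^ 2 / 2 := by
    rw [hu, integral_add hφi hlin, integral_sub (hsub.const_mul _) (integrable_const _),
      integral_const_mul, integral_sub hid (integrable_const a),
      integral_id_gaussianReal]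
    simp
    ring
  have hexp : ∫ x, Real.exp (φ x) ∂gaussianReal b 1 = ∫ x, Real.exp (u x) ∂gaussianReal a 1 := by
    rw [integral_gaussianReal_eq_integral_smul one_ne_zero,
      integral_gaussianReal_eq_integral_smul one_ne_zero]
    congr 1
    funext x
    rw [gaussianPDFReal_eq_mul_exp a b x, hu, Real.exp_add, smul_eq_mul, smul_eq_mul]
    ring
  have hJ : Real.exp (∫ x, u x ∂gaussianReal a 1) ≤ ∫ x, Real.exp (u x) ∂gaussianReal a 1 :=
    convexOn_exp.map_integral_le Real.continuous_exp.continuousOn isClosed_univ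
      (Filter.Eventually.of_forall fun _ => Set.mem_univ _) hui hue
  have := Real.log_le_log (Real.exp_pos _) hJ
  rw [Real.log_exp, hint, ← hexp] at this
  nlinarith [this]

/-- Jensen's inequality for the exponential of a bounded function. -/
theorem integral_le_log_integral_exp {α : Type*} [MeasurableSpace α] (μ : Measure α)
    [IsProbabilityMeasure μ] {φ : α → ℝ} (hφ : Measurable φ) {C : ℝ} (hC : ∀ x, |φ x| ≤ C) :
    ∫ x, φ x ∂μ ≤ Real.log (∫ x, Real.exp (φ x) ∂μ) := by
  have hJ : Real.exp (∫ x, φ x ∂μ) ≤ ∫ x, Real.exp (φ x) ∂μ := by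
    refine convexOn_exp.map_integral_le Real.continuous_exp.continuousOn isClosed_univ
      (Filter.Eventually.of_forall fun _ => Set.mem_univ _) (Integrable.of_abs_le hφ hC)
      (Integrable.of_abs_le (Real.measurable_exp.comp hφ) (C := Real.exp C) fun x => ?_)
    rw [Function.comp_apply, Real.abs_exp]
    exact Real.exp_le_exp.2 (abs_le.1 (hC x)).2
  have := Real.log_le_log (Real.exp_pos _) hJ
  rwa [Real.log_exp] at this

theorem exp_bounds_integral {α : Type*} [MeasurableSpace α] (μ : Measure α)
    [IsProbabilityMeasure μ] {φ : α → ℝ} (hφ : Measurable φ) {C : ℝ} (hC : ∀ x, |φ x| ≤ C) :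
    Real.exp (-C) ≤ ∫ x, Real.exp (φ x) ∂μ ∧ ∫ x, Real.exp (φ x) ∂μ ≤ Real.exp C := by
  have hi : Integrable (fun x => Real.exp (φ x)) μ :=
    Integrable.of_abs_le (Real.measurable_exp.comp hφ) (C := Real.exp C) fun x => by
      rw [Real.abs_exp]
      exact Real.exp_le_exp.2 (abs_le.1 (hC x)).2
  constructor
  · have := integral_mono (μ := μ) (integrable_const (Real.exp (-C))) hi
      fun x => Real.exp_le_exp.2 (abs_le.1 (hC x)).1
    simpa using this
  · have := integral_mono (μ := μ) hi (integrable_const (Real.exp C))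
      fun x => Real.exp_le_exp.2 (abs_le.1 (hC x)).2
    simpa using this

/-! ### Change of measure along an adaptive interaction. -/

namespace Algorithm

variable {N m : ℕ}

/-- Half of the expected sum of the squared differences of two signals along the first `n` queries:
the Kullback-Leibler divergence between the laws of the observations. -/
def divergence (π : Algorithm.{u} N) (f g : ℝ → ℝ) (n : ℕ) : ℝ :=
  ∑ t ∈ Finset.range n,
    ∫ h, (f (π.query t h) - g (π.query t h)) ^ 2 / 2 ∂π.law f t

/-- The Donsker-Varadhan inequality for the laws of the interaction with two signals. -/
theorem integral_law_le (π : Algorithm.{u} N) {f g : ℝ → ℝ} (hf : Measurable f)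
    (hg : Measurable g) {B : ℝ} (hB : ∀ x, |f x - g x| ≤ B) (n : ℕ)
    {φ : π.Seed × (Fin n → ℝ) → ℝ} (hφ : Measurable φ) {C : ℝ} (hC : ∀ h, |φ h| ≤ C) :
    ∫ h, φ h ∂π.law f n ≤
      Real.log (∫ h, Real.exp (φ h) ∂π.law g n) + π.divergence f g n := by
  induction n generalizing C with
  | zero =>
    have := π.isProbabilityMeasure_law hf 0
    have e : π.law f 0 = π.law g 0 := rfl
    simpa [divergence, ← e] using integral_le_log_integral_exp (π.law f 0) hφ hC
  | succ n ih =>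
    have := π.isProbabilityMeasure_law hf n
    have := π.isProbabilityMeasure_law hg n
    have msn : ∀ h : π.Seed × (Fin n → ℝ), Measurable fun y : ℝ =>
        φ (h.1, Fin.snoc (α := fun _ => ℝ) h.2 y) := fun h => hφ.comp
      (measurable_const.prodMk (measurable_snoc.comp (measurable_const.prodMk measurable_id)))
    have mjoint : Measurable fun q : (π.Seed × (Fin n → ℝ)) × ℝ => φ (π.extend g n q) :=
      hφ.comp (π.measurable_extend hg n)
    have mjoint' : Measurable fun q : (π.Seed × (Fin n → ℝ)) × ℝ => φ (π.extend f n q) :=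
      hφ.comp (π.measurable_extend hf n)
    set I : π.Seed × (Fin n → ℝ) → ℝ := fun h =>
      ∫ y, Real.exp (φ (h.1, Fin.snoc (α := fun _ => ℝ) h.2 y))
        ∂gaussianReal (g (π.query n h)) 1 with hI
    have shift : ∀ (k : ℝ → ℝ) (ψ : ℝ → ℝ) (hψ : Measurable ψ) (h : π.Seed × (Fin n → ℝ)),
        ∫ y, ψ (φ (h.1, Fin.snoc (α := fun _ => ℝ) h.2 y)) ∂gaussianReal (k (π.query n h)) 1 =
          ∫ z, ψ (φ (π.extend k n (h, z))) ∂gaussianReal 0 1 := by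
      intro k ψ hψ h
      have e : gaussianReal (k (π.query n h)) 1 =
          (gaussianReal 0 1).map (fun z => k (π.query n h) + z) := by
        rw [gaussianReal_map_const_add, zero_add]
      have m : Measurable fun y => ψ (φ (h.1, Fin.snoc (α := fun _ => ℝ) h.2 y)) :=
        hψ.comp (msn h)
      rw [e, integral_map (by fun_prop) m.aestronglyMeasurable]
      rfl
    have mI : Measurable I := by
      have : I = fun h => ∫ z, Real.exp (φ (π.extend g n (h, z))) ∂gaussianReal 0 1 := by
        funext h
        exact shift g Real.exp Real.measurable_exp h
      rw [this]
      exact (Real.measurable_exp.comp mjoint).stronglyMeasurable.integral_prod_right'.measurable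
    have bI : ∀ h, Real.exp (-C) ≤ I h ∧ I h ≤ Real.exp C := fun h =>
      exp_bounds_integral _ (msn h) fun y => hC _
    have Ipos : ∀ h, 0 < I h := fun h => (Real.exp_pos _).trans_le (bI h).1
    have bψ : ∀ h, |Real.log (I h)| ≤ C := by
      intro h
      rw [abs_le]
      constructor
      · simpa using Real.log_le_log (Real.exp_pos _) (bI h).1
      · simpa using Real.log_le_log (Ipos h) (bI h).2
    have hbd : ∀ h : π.Seed × (Fin n → ℝ),
        |(f (π.query n h) - g (π.query n h)) ^ 2 / 2| ≤ B ^ 2 / 2 := by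
      intro h
      rw [abs_of_nonneg (by positivity)]
      have := sq_le_sq' (by linarith [(abs_le.1 (hB (π.query n h))).1])
        (abs_le.1 (hB (π.query n h))).2
      linarith
    have hDi : Integrable (fun h : π.Seed × (Fin n → ℝ) =>
        (f (π.query n h) - g (π.query n h)) ^ 2 / 2) (π.law f n) := by
      refine Integrable.of_abs_le ?_ hbd
      exact (((π.measurable_query_comp hf n).sub (π.measurable_query_comp hg n)).pow_const
        2).div_const 2
    have hψi : Integrable (fun h => Real.log (I h)) (π.law f n) :=
      Integrable.of_abs_le (Real.measurable_log.comp mI) bψ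
    have hstep : ∫ h, φ h ∂π.law f (n + 1) ≤
        ∫ h, (Real.log (I h) + (f (π.query n h) - g (π.query n h)) ^ 2 / 2) ∂π.law f n := by
      rw [π.integral_law_succ hf n hφ hC]
      refine integral_mono ?_ (hψi.add hDi) fun h =>
        integral_gaussianReal_le_log_integral_exp _ _ (msn h) fun y => hC _
      have : (fun h : π.Seed × (Fin n → ℝ) => ∫ y, φ (h.1, Fin.snoc (α := fun _ => ℝ) h.2 y)
          ∂gaussianReal (f (π.query n h)) 1) =
          fun h => ∫ z, φ (π.extend f n (h, z)) ∂gaussianReal 0 1 := by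
        funext h
        exact shift f id measurable_id h
      rw [this]
      refine Integrable.of_abs_le mjoint'.stronglyMeasurable.integral_prod_right'.measurable
        (C := C) fun h => ?_
      simpa using norm_integral_le_of_norm_le_const (μ := gaussianReal 0 1)
        (f := fun z => φ (π.extend f n (h, z))) (C := C)
        (Filter.Eventually.of_forall fun z => hC _)
    -- Chain rule: the last observation is integrated out by the one-step inequality, and what
    -- remains is the log of the conditional exponential moment. Its exponential integrates back to
    -- the full moment.
    have hih := ih (Real.measurable_log.comp mI) bψ
    have hexp : ∫ h, Real.exp (Real.log (I h)) ∂π.law g n =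
        ∫ h, Real.exp (φ h) ∂π.law g (n + 1) := by
      have m : Measurable fun h => Real.exp (φ h) := Real.measurable_exp.comp hφ
      rw [π.integral_law_succ hg n m (C := Real.exp C) fun h => by
        rw [Real.abs_exp]
        exact Real.exp_le_exp.2 (abs_le.1 (hC h)).2]
      congr 1
      funext h
      rw [Real.exp_log (Ipos h)]
    rw [integral_add hψi hDi] at hstep
    simp only [Function.comp_def, hexp] at hih
    rw [divergence, Finset.sum_range_succ, ← divergence]
    linarith

/-- The expected number of the first `n` queries that fall in `R`. -/
def visits (π : Algorithm.{u} N) (f : ℝ → ℝ) (n : ℕ) (R : Set ℝ) : ℝ :=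
  ∑ t ∈ Finset.range n, (π.law f t).real {h | (π.query t h : ℝ) ∈ R}

theorem measurableSet_query (π : Algorithm.{u} N) (t : ℕ) {R : Set ℝ} (hR : MeasurableSet R) :
    MeasurableSet {h | (π.query t h : ℝ) ∈ R} :=
  (measurable_subtype_coe.comp (π.measurable_query t)) hR

theorem visits_nonneg (π : Algorithm.{u} N) (f : ℝ → ℝ) (n : ℕ) (R : Set ℝ) :
    0 ≤ π.visits f n R := Finset.sum_nonneg fun _ _ => measureReal_nonneg

/-- A query lies in at most one of the disjoint sets. -/
theorem sum_visits_le (π : Algorithm.{u} N) {f : ℝ → ℝ} (hf : Measurable f) (n : ℕ)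
    {ι : Type*} (s : Finset ι) {R : ι → Set ℝ} (hR : ∀ i ∈ s, MeasurableSet (R i))
    (hd : (s : Set ι).PairwiseDisjoint R) :
    ∑ i ∈ s, π.visits f n (R i) ≤ n := by
  unfold visits
  rw [Finset.sum_comm]
  calc _ ≤ ∑ t ∈ Finset.range n, (1 : ℝ) := by
        refine Finset.sum_le_sum fun t _ => ?_
        have := π.isProbabilityMeasure_law hf t
        rw [← measureReal_biUnion_finset (fun i hi j hj hij => ?_)
          fun i hi => π.measurableSet_query t (hR i hi)]
        · exact measureReal_le_one
        · exact (hd hi hj hij).preimage (fun h => (π.query t h : ℝ))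
    _ = n := by simp

/-- A query in `R` costs at most `D ^ 2 / 2`, any other at most `τ ^ 2 / 2`. -/
theorem divergence_le (π : Algorithm.{u} N) {f g : ℝ → ℝ} (hf : Measurable f)
    (n : ℕ) {R : Set ℝ} (hR : MeasurableSet R) {D τ : ℝ}
    (hD : ∀ x ∈ R, |f x - g x| ≤ D) (hτ : ∀ x ∉ R, |f x - g x| ≤ τ) :
    π.divergence f g n ≤ D ^ 2 / 2 * π.visits f n R + n * (τ ^ 2 / 2) := by
  unfold divergence visits
  rw [Finset.mul_sum]
  have : (n : ℝ) * (τ ^ 2 / 2) = ∑ t ∈ Finset.range n, τ ^ 2 / 2 := by simp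
  rw [this, ← Finset.sum_add_distrib]
  refine Finset.sum_le_sum fun t _ => ?_
  have := π.isProbabilityMeasure_law hf t
  have mQ := π.measurableSet_query t hR
  set Q := {h | (π.query t h : ℝ) ∈ R} with hQ
  have hpt : ∀ h : π.Seed × (Fin t → ℝ), (f (π.query t h) - g (π.query t h)) ^ 2 / 2 ≤
      D ^ 2 / 2 * Q.indicator (fun _ => (1 : ℝ)) h + τ ^ 2 / 2 := by
    intro h
    by_cases hh : (π.query t h : ℝ) ∈ R
    · rw [Set.indicator_of_mem (show h ∈ Q from hh)]
      have h1 := abs_le.1 (hD _ hh)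
      nlinarith [sq_le_sq' h1.1 h1.2, sq_nonneg τ]
    · rw [Set.indicator_of_notMem (show h ∉ Q from hh)]
      have h1 := abs_le.1 (hτ _ hh)
      nlinarith [sq_le_sq' h1.1 h1.2]
  have hI : Integrable (Q.indicator (fun _ => (1 : ℝ))) (π.law f t) :=
    (integrable_const 1).indicator mQ
  have hub : Integrable (fun h => D ^ 2 / 2 * Q.indicator (fun _ => (1 : ℝ)) h + τ ^ 2 / 2)
      (π.law f t) := (hI.const_mul _).add (integrable_const _)
  have := integral_mono_of_nonneg (Filter.Eventually.of_forall fun h => by positivity) hub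
    (Filter.Eventually.of_forall hpt)
  rw [integral_add (hI.const_mul _) (integrable_const _), integral_const_mul,
    integral_indicator mQ] at this
  simpa using this

/-- The change-of-measure inequality for an event. -/
theorem mul_law_le_log (π : Algorithm.{u} N) {f g : ℝ → ℝ} (hf : Measurable f)
    (hg : Measurable g) (n : ℕ) {R : Set ℝ} (hR : MeasurableSet R) {D τ : ℝ}
    (hD : ∀ x ∈ R, |f x - g x| ≤ D) (hτ : ∀ x ∉ R, |f x - g x| ≤ τ) (a : ℝ)
    {S : Set (π.Seed × (Fin n → ℝ))} (hS : MeasurableSet S) :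
    a * (π.law f n).real S ≤ Real.log (1 + (Real.exp a - 1) * (π.law g n).real S) +
      (D ^ 2 / 2 * π.visits f n R + n * (τ ^ 2 / 2)) := by
  have := π.isProbabilityMeasure_law hf n
  have := π.isProbabilityMeasure_law hg n
  have hB : ∀ x, |f x - g x| ≤ max D τ := by
    intro x
    by_cases hx : x ∈ R
    · exact (hD x hx).trans (le_max_left _ _)
    · exact (hτ x hx).trans (le_max_right _ _)
  have h := π.integral_law_le hf hg hB n (φ := S.indicator fun _ => a)
    (measurable_const.indicator hS) (C := |a|) (fun h => by
      by_cases hh : h ∈ S <;> simp [hh])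
  have e1 : ∫ h, S.indicator (fun _ => a) h ∂π.law f n = a * (π.law f n).real S := by
    rw [integral_indicator hS]
    simp [mul_comm]
  have e2 : ∫ h, Real.exp (S.indicator (fun _ => a) h) ∂π.law g n =
      1 + (Real.exp a - 1) * (π.law g n).real S := by
    have : (fun h => Real.exp (S.indicator (fun _ => a) h)) =
        fun h => 1 + S.indicator (fun _ => Real.exp a - 1) h := by
      funext h
      by_cases hh : h ∈ S <;> simp [hh]
    rw [this, integral_add (integrable_const _) ((integrable_const _).indicator hS),
      integral_indicator hS]
    simp [mul_comm]
  rw [e1, e2] at h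
  linarith [π.divergence_le hf n hR hD hτ]

end Algorithm

/-! ### Environments with standard Gaussian noise. -/

theorem hasSubgaussianMGF_gaussianReal : HasSubgaussianMGF (fun x : ℝ => x) 1 (gaussianReal 0 1) where
  integrable_exp_mul t := integrable_exp_mul_gaussianReal t
  mgf_le t := by
    rw [mgf_fun_id_gaussianReal]
    simp

namespace Environment

/-- The environment with the given change points and jumps, baseline `0` and standard Gaussian
noise. -/
@[simps]
def ofGaussian {m : ℕ} (loc jump : Fin m → ℝ) (h1 : StrictMono loc)
    (h2 : ∀ i, loc i ∈ Set.Ioo (0 : ℝ) 1) (h3 : ∀ i, jump i ≠ 0) (h4 : ∀ i, |jump i| ≤ 1) :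
    Environment m where
  baseline := 0
  loc := loc
  jump := jump
  noise := gaussianReal 0 1
  loc_strictMono := h1
  loc_mem := h2
  jump_ne_zero := h3
  abs_jump_le_one := h4
  noise_isProbabilityMeasure := inferInstance
  noise_mean := integral_id_gaussianReal
  noise_subGaussian := hasSubgaussianMGF_gaussianReal

theorem measurable_f {m : ℕ} (ν : Environment m) : Measurable ν.f := by
  unfold f
  refine measurable_const.add (Finset.measurable_sum _ fun i _ => ?_)
  exact Measurable.ite measurableSet_Ici measurable_const measurable_const

end Environment

/-! ### Answers given within a fixed number of queries. -/

namespace Algorithm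

variable {N m : ℕ}

theorem prob_eq_gaussProb (π : Algorithm.{u} N) {ν : Environment m}
    (h : ν.noise = gaussianReal 0 1) : π.prob ν = π.gaussProb := by
  rw [prob, gaussProb, h]

theorem stopsAt_of_budget_eq (π : Algorithm.{u} N) (ν : Environment m) (ω : π.Seed × (ℕ → ℝ))
    {t : ℕ} (h : π.budget ν ω = t) : π.StopsAt ν ω t ∧ ∀ v < t, ¬ π.StopsAt ν ω v := by
  have h2 : ∀ v < t, ¬ π.StopsAt ν ω v := by
    intro v hv hs
    have : π.budget ν ω ≤ v := iInf₂_le v hs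
    rw [h] at this
    exact absurd (Nat.cast_le.1 this) (not_le.2 hv)
  refine ⟨?_, h2⟩
  by_contra h1
  have : ((t + 1 : ℕ) : ℕ∞) ≤ π.budget ν ω := by
    refine le_iInf₂ fun v hv => Nat.cast_le.2 ?_
    by_contra hlt
    rcases (Nat.lt_succ_iff.1 (not_le.1 hlt)).lt_or_eq with h' | h'
    · exact h2 v h' hv
    · exact h1 (h' ▸ hv)
  rw [h] at this
  have := Nat.cast_le.1 this
  omega

/-- The history after `t` observations, extracted from a longer one. -/
def take (π : Algorithm.{u} N) {t n : ℕ} (h : t ≤ n) (q : π.Seed × (Fin n → ℝ)) :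
    π.Seed × (Fin t → ℝ) :=
  (q.1, fun i => q.2 (Fin.castLE h i))

theorem measurable_take (π : Algorithm.{u} N) {t n : ℕ} (h : t ≤ n) :
    Measurable (π.take h) :=
  measurable_fst.prodMk (measurable_pi_lambda _ fun i =>
    (measurable_pi_apply (Fin.castLE h i)).comp measurable_snd)

theorem take_history (π : Algorithm.{u} N) (g : ℝ → ℝ) {t n : ℕ} (h : t ≤ n)
    (ω : π.Seed × (ℕ → ℝ)) : π.take h (π.history g n ω) = π.history g t ω :=
  Prod.ext rfl (funext fun i => π.obsOf_take g ω h i)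

/-- The histories along which `π` stops after at most `n` observations with estimates within `η`
of `x`. -/
def answerSet (π : Algorithm.{u} N) (n : ℕ) (η : ℝ) (x : Fin N → ℝ) :
    Set (π.Seed × (Fin n → ℝ)) :=
  {q | ∃ t, ∃ ht : t ≤ n, π.take ht q ∈ π.stopRegion t ∧
    (∀ v, ∀ hv : v < t, π.take (hv.le.trans ht) q ∉ π.stopRegion v) ∧
    ∀ l, |π.decision t (π.take ht q) l - x l| ≤ η}

theorem measurableSet_answerSet (π : Algorithm.{u} N) (n : ℕ) (η : ℝ) (x : Fin N → ℝ) :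
    MeasurableSet (π.answerSet n η x) := by
  simp only [answerSet, Set.ofPred_exists, Set.ofPred_and, Set.ofPred_forall]
  refine MeasurableSet.iUnion fun t => MeasurableSet.iUnion fun ht => ?_
  refine (π.measurable_take ht (π.measurableSet_stopRegion t)).inter (MeasurableSet.inter ?_ ?_)
  · exact MeasurableSet.iInter fun v => MeasurableSet.iInter fun hv =>
      (π.measurable_take _ (π.measurableSet_stopRegion v)).compl
  · refine MeasurableSet.iInter fun l => ?_
    have : Measurable fun q => π.decision t (π.take ht q) l :=
      (measurable_pi_apply l).comp ((π.measurable_decision t).comp (π.measurable_take ht))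
    exact measurableSet_le (this.sub measurable_const).norm measurable_const

/-- The history determines the first stopping time, so both memberships speak of the same estimates.
Hence answer sets of separated configurations are disjoint events. -/
theorem abs_sub_le_of_mem_answerSet (π : Algorithm.{u} N) {n : ℕ} {η : ℝ} {x y : Fin N → ℝ}
    {q : π.Seed × (Fin n → ℝ)} (hx : q ∈ π.answerSet n η x) (hy : q ∈ π.answerSet n η y)
    (l : Fin N) : |x l - y l| ≤ 2 * η := by
  obtain ⟨t, ht, h1, h2, h3⟩ := hx
  obtain ⟨v, hv, h4, h5, h6⟩ := hy
  have e : t = v := by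
    rcases lt_trichotomy t v with h | h | h
    · exact absurd h1 (h5 t h)
    · exact h
    · exact absurd h4 (h2 v h)
  subst e
  have a := abs_le.1 (h3 l)
  have b := abs_le.1 (h6 l)
  exact abs_le.2 ⟨by linarith, by linarith⟩

theorem disjoint_answerSet (π : Algorithm.{u} N) (n : ℕ) {η : ℝ} {x y : Fin N → ℝ} {l : Fin N}
    (h : 2 * η < |x l - y l|) : Disjoint (π.answerSet n η x) (π.answerSet n η y) :=
  Set.disjoint_left.2 fun _ hx hy => absurd (π.abs_sub_le_of_mem_answerSet hx hy l) (not_le.2 h)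

theorem mem_answerSet_of_budget_eq (π : Algorithm.{u} m) (ν : Environment m) {n : ℕ} {η : ℝ}
    {ω : π.Seed × (ℕ → ℝ)} {t : ℕ} (h : π.budget ν ω = t) (ht : t ≤ n)
    {i : Fin m → Fin m} (hi : StrictMono i)
    (hd : ∀ l, |π.decision t (ω.1, π.obs ν ω t) l - ν.loc (i l)| ≤ η) :
    π.history ν.f n ω ∈ π.answerSet n η ν.loc := by
  obtain ⟨h1, h2⟩ := π.stopsAt_of_budget_eq ν ω h
  -- With exactly `m` change points, a strictly monotone matching can only be the identity.
  have hid : ∀ l, i l = l := fun l => congrFun hi.eq_id l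
  refine ⟨t, ht, ?_, fun v hv => ?_, fun l => ?_⟩
  · rw [take_history, history, ← obs_eq_obsOf]
    exact h1
  · rw [take_history, history, ← obs_eq_obsOf]
    exact h2 v hv
  · rw [take_history, history, ← obs_eq_obsOf]
    simpa [hid] using hd l

/-- If `π` rarely exceeds the budget, then it rarely fails within the budget. -/
theorem le_law_answerSet (π : Algorithm.{u} m) {δ η A : ℝ} (hπ : π.IsCorrect δ η)
    (ν : Environment m) (hν : ν.noise = gaussianReal 0 1) {n : ℕ} (hn : ∀ t : ℕ, (t : ℝ) < A → t ≤ n)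
    (hA : (π.prob ν).real {ω | ENNReal.ofReal A ≤ (π.budget ν ω : ENNReal)} < δ) :
    1 - 2 * δ ≤ (π.law ν.f n).real (π.answerSet n η ν.loc) := by
  have h := hπ m le_rfl ν
  have hsub : π.correctEvent ν η ⊆ (π.history ν.f n) ⁻¹' (π.answerSet n η ν.loc) ∪
      {ω | ENNReal.ofReal A ≤ (π.budget ν ω : ENNReal)} := by
    rintro ω ⟨t, ht, i, hi, hd⟩
    by_cases hlt : (t : ℝ) < A
    · exact Or.inl (π.mem_answerSet_of_budget_eq ν ht (hn t hlt) hi hd)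
    · refine Or.inr ?_
      simp only [Set.mem_ofPred_eq, ht]
      rw [ENat.toENNReal_coe, ← ENNReal.ofReal_natCast]
      exact ENNReal.ofReal_le_ofReal (not_lt.1 hlt)
  have : IsProbabilityMeasure (π.prob ν) := by unfold prob; infer_instance
  have h2 := (measureReal_mono hsub (measure_ne_top (π.prob ν) _)).trans
    (measureReal_union_le _ _)
  rw [π.prob_eq_gaussProb hν] at h2 h hA
  rw [law, map_measureReal_apply (π.measurable_history ν.measurable_f n)
    (π.measurableSet_answerSet n η _)]
  linarith

/-- Estimates that are accurate for far-away points are wrong. -/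
theorem law_answerSet_le (π : Algorithm.{u} m) {δ η : ℝ} (hπ : π.IsCorrect δ η)
    (ν : Environment m) (hν : ν.noise = gaussianReal 0 1) (n : ℕ) {x : Fin m → ℝ} {l : Fin m}
    (hx : 2 * η < |x l - ν.loc l|) :
    (π.law ν.f n).real (π.answerSet n η x) ≤ δ := by
  have hS := π.measurableSet_answerSet n η x
  have hH := π.measurable_history ν.measurable_f n
  have h := hπ m le_rfl ν
  have hsub : π.correctEvent ν η ⊆ ((π.history ν.f n) ⁻¹' (π.answerSet n η x))ᶜ := by
    rintro ω ⟨t, ht, i, hi, hd⟩ hmem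
    obtain ⟨v, hv, h1, h2, -⟩ := id hmem
    obtain ⟨h3, h4⟩ := π.stopsAt_of_budget_eq ν ω ht
    -- The history already contains a stop at `v ≤ n`, and `t` is the first stop.
    have htn : t ≤ n := by
      by_contra hlt
      refine h4 v (hv.trans_lt (not_le.1 hlt)) ?_
      rw [take_history, history, ← obs_eq_obsOf] at h1
      exact h1
    exact Set.disjoint_left.1 (π.disjoint_answerSet n hx) hmem
      (π.mem_answerSet_of_budget_eq ν ht htn hi hd)
  rw [π.prob_eq_gaussProb hν] at h
  have h2 := measureReal_mono hsub (measure_ne_top π.gaussProb _)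
  rw [probReal_compl_eq_one_sub (hH hS)] at h2
  rw [law, map_measureReal_apply hH hS]
  linarith

end Algorithm

/-! ### Spacings, energies and comparable environments. -/

namespace Environment

variable {m : ℕ}

theorem gap_of_succ (ν : Environment m) {i j : Fin m} (h : (j : ℕ) = i + 1) :
    ν.gap j = ν.loc j - ν.loc i := by
  rw [gap, dif_pos ⟨by omega, j.2⟩]
  congr 2
  exact Fin.ext (by simp [h])

theorem gap_zero (ν : Environment m) : ν.gap 0 = 1 := by simp [gap]

theorem gap_self (ν : Environment m) : ν.gap m = 1 := by simp [gap]

theorem le_gap (ν : Environment m) {c : ℝ} (h1 : c ≤ 1) {i : Fin m}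
    (h : ∀ j : Fin m, (i : ℕ) = j + 1 → c ≤ ν.loc i - ν.loc j) : c ≤ ν.gap i := by
  by_cases h0 : (i : ℕ) = 0
  · rw [h0, gap_zero]
    exact h1
  · have e : (i : ℕ) = ((⟨i - 1, by omega⟩ : Fin m) : ℕ) + 1 := by
      simp only
      omega
    rw [ν.gap_of_succ e]
    exact h _ e

theorem le_gap_succ (ν : Environment m) {c : ℝ} (h1 : c ≤ 1) {i : Fin m}
    (h : ∀ j : Fin m, (j : ℕ) = i + 1 → c ≤ ν.loc j - ν.loc i) : c ≤ ν.gap (i + 1) := by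
  by_cases h0 : (i : ℕ) + 1 = m
  · rw [h0, gap_self]
    exact h1
  · have e : ((⟨i + 1, by omega⟩ : Fin m) : ℕ) = i + 1 := rfl
    rw [← e, ν.gap_of_succ e]
    exact h _ e

theorem le_spacing (ν : Environment m) {c : ℝ} (h1 : c ≤ 1) {i : Fin m}
    (hl : ∀ j : Fin m, (i : ℕ) = j + 1 → c ≤ ν.loc i - ν.loc j)
    (hr : ∀ j : Fin m, (j : ℕ) = i + 1 → c ≤ ν.loc j - ν.loc i) : c ≤ ν.spacing i :=
  le_min (ν.le_gap h1 hl) (ν.le_gap_succ h1 hr)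

theorem spacing_le_right (ν : Environment m) {i j : Fin m} (h : (j : ℕ) = i + 1) :
    ν.spacing i ≤ ν.loc j - ν.loc i :=
  (min_le_right _ _).trans_eq (by rw [← h, ν.gap_of_succ h])

theorem spacing_le_left (ν : Environment m) {i j : Fin m} (h : (j : ℕ) = i + 1) :
    ν.spacing j ≤ ν.loc j - ν.loc i :=
  (min_le_left _ _).trans_eq (ν.gap_of_succ h)

theorem gap_le_one (ν : Environment m) (k : ℕ) : ν.gap k ≤ 1 := by
  unfold gap
  split_ifs with h
  · linarith [(ν.loc_mem ⟨k, h.2⟩).2, (ν.loc_mem ⟨k - 1, by omega⟩).1]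
  · exact le_rfl

theorem gap_pos (ν : Environment m) (k : ℕ) : 0 < ν.gap k := by
  unfold gap
  split_ifs with h
  · exact sub_pos.2 (ν.loc_strictMono (by simp only [Fin.mk_lt_mk]; omega))
  · exact one_pos

theorem spacing_le_one (ν : Environment m) (i : Fin m) : ν.spacing i ≤ 1 :=
  (min_le_left _ _).trans (ν.gap_le_one _)

theorem spacing_pos (ν : Environment m) (i : Fin m) : 0 < ν.spacing i :=
  lt_min (ν.gap_pos _) (ν.gap_pos _)

/-- A spacing below `1` cannot come from the convention at the two ends, so it is a true distance
between neighbours. -/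
theorem exists_adjacent (ν : Environment m) {i : Fin m} (h : ν.spacing i < 1) :
    ∃ a b : Fin m, (b : ℕ) = a + 1 ∧ (a = i ∨ b = i) ∧ ν.spacing i = ν.loc b - ν.loc a := by
  rcases min_choice (ν.gap i) (ν.gap (i + 1)) with h' | h'
  · have hi : (i : ℕ) ≠ 0 := fun h0 => by
      rw [spacing, h', h0, gap_zero] at h
      exact lt_irrefl _ h
    have e : (i : ℕ) = ((⟨i - 1, by omega⟩ : Fin m) : ℕ) + 1 := by
      simp only
      omega
    exact ⟨_, i, e, Or.inr rfl, by rw [spacing, h', ν.gap_of_succ e]⟩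
  · have hi : (i : ℕ) + 1 ≠ m := fun h0 => by
      rw [spacing, h', h0, gap_self] at h
      exact lt_irrefl _ h
    have e : ((⟨i + 1, by omega⟩ : Fin m) : ℕ) = i + 1 := rfl
    exact ⟨i, _, e, Or.inl rfl, by rw [spacing, h', ← ν.gap_of_succ e]⟩

theorem sq_jump_pos (ν : Environment m) (i : Fin m) : 0 < ν.jump i ^ 2 := by
  have := ν.jump_ne_zero i
  positivity

theorem sq_jump_le_one (ν : Environment m) (i : Fin m) : ν.jump i ^ 2 ≤ 1 :=
  (sq_le_one_iff_abs_le_one _).2 (ν.abs_jump_le_one i)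

theorem energySq_pos (ν : Environment m) (i : Fin m) : 0 < ν.energySq i :=
  mul_pos (ν.spacing_pos i) (ν.sq_jump_pos i)

theorem le_hDetect (ν : Environment m) (i : Fin m) : 1 / ν.energySq i ≤ ν.hDetect :=
  le_ciSup (f := fun i => 1 / ν.energySq i) (Set.finite_range _).bddAbove i

theorem hDetect_le (ν : Environment m) (hm : 1 ≤ m) {c : ℝ} (hc : 0 < c)
    (h : ∀ i, c ≤ ν.energySq i) : ν.hDetect ≤ 1 / c := by
  have : Nonempty (Fin m) := ⟨⟨0, hm⟩⟩
  exact ciSup_le fun i => one_div_le_one_div_of_le hc (h i)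

theorem exists_hDetect_eq (ν : Environment m) (hm : 1 ≤ m) :
    ∃ i, ν.hDetect = 1 / ν.energySq i ∧ ∀ j, ν.energySq i ≤ ν.energySq j := by
  have : Nonempty (Fin m) := ⟨⟨0, hm⟩⟩
  obtain ⟨i, hi⟩ := Finite.exists_min ν.energySq
  exact ⟨i, le_antisymm (ν.hDetect_le hm (ν.energySq_pos i) hi) (ν.le_hDetect i), hi⟩

theorem hLocalize_eq (ν : Environment m) : ν.hLocalize m = ∑ i, 1 / ν.jump i ^ 2 := by
  rw [hLocalize, ← Equiv.sum_comp (Tuple.sort fun i => -|ν.jump i|) fun i => 1 / ν.jump i ^ 2]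
  exact Finset.sum_congr rfl fun i _ => by rw [if_pos i.2, sortedJump]

theorem hLocalize_nonneg (ν : Environment m) : 0 ≤ ν.hLocalize m := by
  rw [hLocalize_eq]
  exact Finset.sum_nonneg fun i _ => by positivity

theorem hDetect_nonneg (ν : Environment m) (hm : 1 ≤ m) : 0 ≤ ν.hDetect :=
  (one_div_pos.2 (ν.energySq_pos ⟨0, hm⟩)).le.trans (ν.le_hDetect _)

/-- The complexities of `ν'` are those of `ν` up to constant factors. -/
structure Comparable (ν ν' : Environment m) : Prop where
  hDetect_ge : ν.hDetect ≤ ν'.hDetect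
  hDetect_le : ν'.hDetect ≤ 4 * ν.hDetect
  hLocalize_ge : 1 / 2 * ν.hLocalize m ≤ ν'.hLocalize m
  hLocalize_le : ν'.hLocalize m ≤ ν.hLocalize m

/-- Changing the locations so that the distances of neighbours shrink, by a factor of at most
`4`, yields a comparable environment. -/
theorem comparable_of_gap (ν ν' : Environment m) (hm : 1 ≤ m)
    (hj : ∀ i, ν'.jump i ^ 2 = ν.jump i ^ 2)
    (h1 : ∀ i j : Fin m, (j : ℕ) = i + 1 → (ν.loc j - ν.loc i) / 4 ≤ ν'.loc j - ν'.loc i)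
    (h2 : ∀ i j : Fin m, (j : ℕ) = i + 1 → ν'.loc j - ν'.loc i ≤ ν.loc j - ν.loc i) :
    Comparable ν ν' := by
  have hs1 : ∀ i, ν.spacing i / 4 ≤ ν'.spacing i := fun i =>
    ν'.le_spacing (by linarith [ν.spacing_le_one i])
      (fun j h => by linarith [h1 j i h, ν.spacing_le_left h])
      (fun j h => by linarith [h1 i j h, ν.spacing_le_right h])
  have hs2 : ∀ i, ν'.spacing i ≤ ν.spacing i := fun i =>
    ν.le_spacing (ν'.spacing_le_one i)
      (fun j h => by linarith [h2 j i h, ν'.spacing_le_left h])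
      (fun j h => by linarith [h2 i j h, ν'.spacing_le_right h])
  have hl : ν'.hLocalize m = ν.hLocalize m := by
    rw [hLocalize_eq, hLocalize_eq]
    exact Finset.sum_congr rfl fun i _ => by rw [hj]
  obtain ⟨i, hi, hmin⟩ := ν.exists_hDetect_eq hm
  refine ⟨?_, ?_, by linarith [ν.hLocalize_nonneg], hl.le⟩
  · rw [hi]
    refine le_trans (one_div_le_one_div_of_le (ν'.energySq_pos i) ?_) (ν'.le_hDetect i)
    rw [energySq, energySq, hj]
    exact mul_le_mul_of_nonneg_right (hs2 i) (sq_nonneg _)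
  · have := ν'.hDetect_le hm (c := ν.energySq i / 4) (by linarith [ν.energySq_pos i]) fun k => by
      have h3 := hmin k
      have h4 := mul_le_mul_of_nonneg_right (hs1 k) (sq_nonneg (ν.jump k))
      rw [energySq, energySq] at h3
      rw [energySq, energySq, hj]
      linarith
    rw [hi]
    refine this.trans_eq ?_
    rw [one_div_div]
    ring

/-- The alternating signs of the jumps of the perturbed environments. -/
def altJump (ν : Environment m) (i : Fin m) : ℝ := (-1) ^ (i : ℕ) * |ν.jump i|

theorem abs_altJump (ν : Environment m) (i : Fin m) : |ν.altJump i| = |ν.jump i| := by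
  simp [altJump, abs_mul]

/-- The shift is at most `3/8` of the distance to the next point, less than the `5/8` left after
compression. This gives both the order of the shifted points and the disjointness of the windows. -/
theorem lt_of_loc_add (ν : Environment m) {w : Fin m → ℝ}
    (h1 : ∀ i, w i ≤ 3 / 8 * ν.spacing i) {i j : Fin m} (h : i < j) :
    5 / 8 * ν.loc i + w i < 5 / 8 * ν.loc j := by
  set k : Fin m := ⟨i + 1, by have := j.2; have : (i : ℕ) < j := h; omega⟩ with hk
  have hs := ν.spacing_le_right (i := i) (j := k) rfl
  have h2 : ν.loc k ≤ ν.loc j := ν.loc_strictMono.monotone (Fin.le_def.2 (by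
    have : (i : ℕ) < j := h
    simp only [hk]; omega))
  have h3 : ν.loc i < ν.loc k := ν.loc_strictMono (Fin.lt_def.2 (by simp [hk]))
  linarith [h1 i]

theorem strictMono_loc_add (ν : Environment m) {w : Fin m → ℝ} (h0 : ∀ i, 0 ≤ w i)
    (h1 : ∀ i, w i ≤ 3 / 8 * ν.spacing i) : StrictMono fun i => 5 / 8 * ν.loc i + w i :=
  fun i j h => by
    have := ν.lt_of_loc_add h1 h
    have := h0 j
    simp only
    linarith

/-- The environment with alternating jumps whose change points are compressed and then shifted. -/
def perturb (ν : Environment m) (w : Fin m → ℝ) (h0 : ∀ i, 0 ≤ w i)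
    (h1 : ∀ i, w i ≤ 3 / 8 * ν.spacing i) : Environment m :=
  ofGaussian (fun i => 5 / 8 * ν.loc i + w i) ν.altJump (ν.strictMono_loc_add h0 h1)
    (fun i => ⟨by linarith [(ν.loc_mem i).1, h0 i],
      by linarith [(ν.loc_mem i).2, h1 i, ν.spacing_le_one i]⟩)
    (fun i => abs_ne_zero.1 (by rw [abs_altJump]; exact abs_ne_zero.2 (ν.jump_ne_zero i)))
    (fun i => (ν.abs_altJump i).trans_le (ν.abs_jump_le_one i))

theorem perturb_loc (ν : Environment m) {w : Fin m → ℝ} (h0 : ∀ i, 0 ≤ w i)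
    (h1 : ∀ i, w i ≤ 3 / 8 * ν.spacing i) (i : Fin m) :
    (ν.perturb w h0 h1).loc i = 5 / 8 * ν.loc i + w i := rfl

theorem perturb_jump (ν : Environment m) {w : Fin m → ℝ} (h0 : ∀ i, 0 ≤ w i)
    (h1 : ∀ i, w i ≤ 3 / 8 * ν.spacing i) (i : Fin m) :
    (ν.perturb w h0 h1).jump i = ν.altJump i := rfl

/-- A gap `g` becomes at least `5g/8 - 3g/8 = g/4` and at most `5g/8 + 3g/8 = g`; this explains the
constants `5/8` and `3/8`. -/
theorem comparable_perturb (ν : Environment m) (hm : 1 ≤ m) (w : Fin m → ℝ) (h0 : ∀ i, 0 ≤ w i)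
    (h1 : ∀ i, w i ≤ 3 / 8 * ν.spacing i) : Comparable ν (ν.perturb w h0 h1) := by
  refine comparable_of_gap ν _ hm (fun i => ?_) (fun i j h => ?_) (fun i j h => ?_)
  · rw [perturb_jump, ← sq_abs, abs_altJump, sq_abs]
  · rw [perturb_loc, perturb_loc]
    linarith [h0 j, h1 i, ν.spacing_le_right h]
  · rw [perturb_loc, perturb_loc]
    linarith [h0 i, h1 j, ν.spacing_le_left h]

end Environment

/-! ### Elementary estimates on the confidence term. -/

/-- Through `√δ`, the left side is at most `4 (√δ - δ)`, and `(2 √δ - 1) ^ 2 ≥ 0`. -/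
theorem two_mul_mul_log_inv_le_one {δ : ℝ} (hδ : 0 < δ) : 2 * δ * Real.log (1 / δ) ≤ 1 := by
  have hs : 0 < √δ := Real.sqrt_pos.2 hδ
  have e : √δ * √δ = δ := Real.mul_self_sqrt hδ.le
  have h1 : Real.log (1 / δ) = 2 * Real.log (1 / √δ) := by
    rw [one_div, one_div, Real.log_inv, Real.log_inv, Real.log_sqrt hδ.le]
    ring
  have h2 : Real.log (1 / √δ) ≤ 1 / √δ - 1 := Real.log_le_sub_one_of_pos (by positivity)
  have h3 : δ * (1 / √δ) = √δ := by
    rw [mul_one_div, div_eq_iff hs.ne', e]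
  rw [h1]
  nlinarith [mul_le_mul_of_nonneg_left h2 hδ.le, sq_nonneg (2 * √δ - 1)]

theorem log_one_div_eight_mul {δ : ℝ} (hδ : 0 < δ) :
    Real.log (1 / (8 * δ)) = Real.log (1 / δ) - 3 * Real.log 2 := by
  have : (8 : ℝ) = 2 ^ 3 := by norm_num
  rw [one_div, one_div, Real.log_inv, Real.log_inv, Real.log_mul (by norm_num) hδ.ne', this,
    Real.log_pow]
  push_cast
  ring

theorem log_one_div_eight_mul_add_le {δ : ℝ} (hδ : 0 < δ) :
    Real.log (1 / (8 * δ)) + 1 / 4 ≤ (1 - 2 * δ) * Real.log (1 / δ) - Real.log 2 := by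
  rw [log_one_div_eight_mul hδ]
  linarith [two_mul_mul_log_inv_le_one hδ, Real.log_two_gt_d9]

/-! ### Merging a change point with the next one. -/

namespace Environment

variable {m : ℕ}

/-- The locations of the compressed environment with an additional point on the far right. -/
def extLoc (ν : Environment m) : Fin (m + 1) → ℝ :=
  Fin.snoc (α := fun _ => ℝ) (fun i => 5 / 8 * ν.loc i) (15 / 16)

/-- The alternating jumps with an additional jump of magnitude `τ`. -/
def extJump (ν : Environment m) (τ : ℝ) : Fin (m + 1) → ℝ :=
  Fin.snoc (α := fun _ => ℝ) ν.altJump ((-1) ^ m * τ)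

theorem extLoc_castSucc (ν : Environment m) (i : Fin m) :
    ν.extLoc i.castSucc = 5 / 8 * ν.loc i := by simp [extLoc]

theorem extLoc_last (ν : Environment m) : ν.extLoc (Fin.last m) = 15 / 16 := by simp [extLoc]

theorem extJump_castSucc (ν : Environment m) (τ : ℝ) (i : Fin m) :
    ν.extJump τ i.castSucc = ν.altJump i := by simp [extJump]

theorem extJump_last (ν : Environment m) (τ : ℝ) :
    ν.extJump τ (Fin.last m) = (-1) ^ m * τ := by simp [extJump]

theorem strictMono_extLoc (ν : Environment m) : StrictMono ν.extLoc := by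
  intro i j h
  induction j using Fin.lastCases with
  | last =>
    induction i using Fin.lastCases with
    | last => exact absurd h (lt_irrefl _)
    | cast i =>
      rw [extLoc_castSucc, extLoc_last]
      linarith [(ν.loc_mem i).2]
  | cast j =>
    induction i using Fin.lastCases with
    | last => exact absurd h (not_lt.2 (Fin.le_last _))
    | cast i =>
      rw [extLoc_castSucc, extLoc_castSucc]
      linarith [ν.loc_strictMono (Fin.castSucc_lt_castSucc_iff.1 h)]

theorem extLoc_mem (ν : Environment m) (i : Fin (m + 1)) : ν.extLoc i ∈ Set.Ioo (0 : ℝ) 1 := by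
  induction i using Fin.lastCases with
  | last => rw [extLoc_last]; norm_num
  | cast i =>
    rw [extLoc_castSucc]
    exact ⟨by linarith [(ν.loc_mem i).1], by linarith [(ν.loc_mem i).2]⟩

/-- The jumps after the `i`-th change point has been merged with the next one. -/
def mergedJump (ν : Environment m) (i : Fin m) (τ : ℝ) (k : Fin (m + 1)) : ℝ :=
  ν.extJump τ k + if k = i.succ then ν.altJump i - (-1) ^ (i : ℕ) * τ else 0

/-- The magnitudes of the extended jumps. -/
theorem extJump_eq (ν : Environment m) {τ : ℝ} (hτ : 0 < τ) (hτ1 : τ ≤ 1) (k : Fin (m + 1)) :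
    ∃ D : ℝ, ν.extJump τ k = (-1) ^ (k : ℕ) * D ∧ 0 < D ∧ D ≤ 1 ∧
      (D = τ ∨ ∃ j, D = |ν.jump j|) := by
  induction k using Fin.lastCases with
  | last => exact ⟨τ, by simp [extJump_last], hτ, hτ1, Or.inl rfl⟩
  | cast j => exact ⟨|ν.jump j|, by rw [extJump_castSucc]; rfl, abs_pos.2 (ν.jump_ne_zero j),
      ν.abs_jump_le_one j, Or.inr ⟨j, rfl⟩⟩

/-- Neighbouring jumps have opposite signs, so the merged jump is `± (|Δ_i| - τ - D)`, a difference
of numbers in `(0, 1]`; this is why jumps alternate. The excluded values of `τ` are those at which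
it could vanish. -/
theorem mergedJump_spec (ν : Environment m) (i : Fin m) {τ : ℝ} (hτ : 0 < τ)
    (hτi : τ < |ν.jump i|) (h1 : τ ≠ |ν.jump i| / 2) (h2 : ∀ j, τ ≠ |ν.jump i| - |ν.jump j|)
    (k : Fin (m + 1)) : ν.mergedJump i τ k ≠ 0 ∧ |ν.mergedJump i τ k| ≤ 1 := by
  have hi1 := ν.abs_jump_le_one i
  obtain ⟨D, hD, hD0, hD1, hD2⟩ := ν.extJump_eq hτ (hτi.le.trans hi1) k
  unfold mergedJump
  rw [hD]
  split_ifs with h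
  · have e : (-1) ^ (k : ℕ) * D + (ν.altJump i - (-1) ^ (i : ℕ) * τ) =
        (-1) ^ (i : ℕ) * (|ν.jump i| - τ - D) := by
      rw [h, altJump, Fin.val_succ, pow_succ]
      ring
    rw [e]
    constructor
    · refine mul_ne_zero (by simp) fun h0 => ?_
      rcases hD2 with hD2 | ⟨j, hD2⟩
      · exact h1 (by linarith)
      · exact h2 j (by linarith)
    · rw [abs_mul, abs_pow, abs_neg, abs_one, one_pow, one_mul, abs_le]
      constructor <;> linarith
  · rw [add_zero]
    refine ⟨mul_ne_zero (by simp) hD0.ne', ?_⟩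
    rw [abs_mul, abs_pow, abs_neg, abs_one, one_pow, one_mul, abs_of_pos hD0]
    exact hD1

/-- The environment without the `i`-th change point: the jump is moved to the next change point, and
a tiny change point is added on the far right. -/
def merge (ν : Environment m) (i : Fin m) {τ : ℝ} (hτ : 0 < τ)
    (hτi : τ < |ν.jump i|) (h1 : τ ≠ |ν.jump i| / 2) (h2 : ∀ j, τ ≠ |ν.jump i| - |ν.jump j|) :
    Environment m :=
  ofGaussian (fun j => ν.extLoc (i.castSucc.succAbove j))
    (fun j => ν.mergedJump i τ (i.castSucc.succAbove j))
    (ν.strictMono_extLoc.comp (Fin.strictMono_succAbove _)) (fun _ => ν.extLoc_mem _)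
    (fun _ => (ν.mergedJump_spec i hτ hτi h1 h2 _).1)
    (fun _ => (ν.mergedJump_spec i hτ hτi h1 h2 _).2)

/-- The compressed environment with alternating jumps. -/
def compress (ν : Environment m) : Environment m :=
  ν.perturb 0 (fun _ => le_rfl) (fun i => by
    have := ν.spacing_pos i
    simp only [Pi.zero_apply]
    positivity)

theorem compress_loc (ν : Environment m) (i : Fin m) : ν.compress.loc i = 5 / 8 * ν.loc i :=
  add_zero _

theorem compress_f (ν : Environment m) (x : ℝ) :
    ν.compress.f x = ∑ i, if 5 / 8 * ν.loc i ≤ x then ν.altJump i else 0 := by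
  rw [f, show ν.compress.baseline = 0 from rfl, zero_add]
  exact Finset.sum_congr rfl fun i _ => by rw [compress_loc]; rfl

/-- Both signals are compared with the extended one with `m + 1` change points: the compressed
signal lacks its last term, the merged signal lacks term `i` and has the correction at `i.succ`. -/
theorem compress_f_sub_merge_f (ν : Environment m) (i : Fin m) {τ : ℝ} (hτ : 0 < τ)
    (hτi : τ < |ν.jump i|) (h1 : τ ≠ |ν.jump i| / 2) (h2 : ∀ j, τ ≠ |ν.jump i| - |ν.jump j|)
    (x : ℝ) :
    ν.compress.f x - (ν.merge i hτ hτi h1 h2).f x =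
      (if ν.extLoc i.castSucc ≤ x then ν.altJump i else 0) -
      (if ν.extLoc i.succ ≤ x then ν.altJump i - (-1) ^ (i : ℕ) * τ else 0) -
      (if ν.extLoc (Fin.last m) ≤ x then (-1) ^ m * τ else 0) := by
  have e1 : (ν.merge i hτ hτi h1 h2).f x = ∑ j, if ν.extLoc (i.castSucc.succAbove j) ≤ x then
      ν.mergedJump i τ (i.castSucc.succAbove j) else 0 := zero_add _
  have e2 := Fin.sum_univ_succAbove
    (fun k => if ν.extLoc k ≤ x then ν.mergedJump i τ k else 0) i.castSucc
  have e3 : ∑ k, (if ν.extLoc k ≤ x then ν.mergedJump i τ k else 0) =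
      ∑ k, (if ν.extLoc k ≤ x then ν.extJump τ k else 0) +
        (if ν.extLoc i.succ ≤ x then ν.altJump i - (-1) ^ (i : ℕ) * τ else 0) := by
    have e : ∀ k, (if ν.extLoc k ≤ x then ν.mergedJump i τ k else 0) =
        (if ν.extLoc k ≤ x then ν.extJump τ k else 0) + if k = i.succ then
          (if ν.extLoc i.succ ≤ x then ν.altJump i - (-1) ^ (i : ℕ) * τ else 0) else 0 := by
      intro k
      unfold mergedJump
      by_cases hk : k = i.succ
      · subst hk
        split_ifs <;> simp
      · simp [hk]
    rw [Finset.sum_congr rfl fun k _ => e k, Finset.sum_add_distrib, Finset.sum_ite_eq',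
      if_pos (Finset.mem_univ _)]
  have e4 := Fin.sum_univ_castSucc fun k => if ν.extLoc k ≤ x then ν.extJump τ k else 0
  have e5 : ν.mergedJump i τ i.castSucc = ν.altJump i := by
    rw [mergedJump, if_neg (by simp [Fin.ext_iff]), add_zero, extJump_castSucc]
  simp only [extLoc_castSucc, extJump_castSucc, extJump_last] at e4
  rw [← compress_f] at e4
  simp only [e5] at e2
  rw [e1]
  linarith

end Environment

/-! ### Queries needed for the confidence level. -/

namespace Algorithm

variable {m : ℕ}

theorem le_visits_of_correct (π : Algorithm.{u} m) {δ η : ℝ} (hδ : δ ∈ Set.Ioo (0 : ℝ) (1 / 8))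
    (hη : η < 1 / 8) (hπ : π.IsCorrect δ η) (ν : Environment m) (n : ℕ)
    (h : 1 - 2 * δ ≤ (π.law ν.compress.f n).real (π.answerSet n η ν.compress.loc)) (i : Fin m) :
    2 * (1 / ν.jump i ^ 2) * Real.log (1 / (8 * δ)) ≤
      π.visits ν.compress.f n (Set.Ico (ν.extLoc i.castSucc) (ν.extLoc i.succ)) := by
  obtain ⟨hδ0, hδ1⟩ := hδ
  have hDi : 0 < |ν.jump i| := abs_pos.2 (ν.jump_ne_zero i)
  -- Small enough that `n` queries outside the interval contribute at most `1/4` to the divergence,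
  -- and avoiding finitely many values that could create a zero jump.
  obtain ⟨τ, ⟨hτ0, hτ1⟩, hτ2⟩ : ∃ τ, τ ∈ Set.Ioo 0 (min |ν.jump i| (1 / (4 * (n + 1)))) ∧
      τ ∉ insert (|ν.jump i| / 2) (Set.range fun j => |ν.jump i| - |ν.jump j|) := by
    refine ((Set.Ioo_infinite (lt_min hDi (by positivity))).sdiff
      ((Set.finite_range _).insert _)).nonempty
  rw [Set.mem_insert_iff, not_or] at hτ2
  have h2 : ∀ j, τ ≠ |ν.jump i| - |ν.jump j| := fun j hj => hτ2.2 ⟨j, hj.symm⟩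
  have hτi := hτ1.trans_le (min_le_left _ _)
  have hτn := hτ1.trans_le (min_le_right _ _)
  set ν' := ν.merge i hτ0 hτi hτ2.1 h2 with hν'
  have hdiff : ∀ x, _ := ν.compress_f_sub_merge_f i hτ0 hτi hτ2.1 h2
  have hmono := ν.strictMono_extLoc
  have hlt : ν.extLoc i.castSucc < ν.extLoc i.succ := hmono (Fin.castSucc_lt_succ)
  have hle : ν.extLoc i.succ ≤ ν.extLoc (Fin.last m) := hmono.monotone (Fin.le_last _)
  have hsgn : ∀ k : ℕ, |(-1 : ℝ) ^ k * τ| = τ := fun k => by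
    rw [abs_mul, abs_pow, abs_neg, abs_one, one_pow, one_mul, abs_of_pos hτ0]
  have hR : ∀ x ∈ Set.Ico (ν.extLoc i.castSucc) (ν.extLoc i.succ),
      |ν.compress.f x - ν'.f x| ≤ |ν.jump i| := by
    intro x hx
    rw [hdiff, if_pos hx.1, if_neg (not_le.2 hx.2), if_neg (not_le.2 (hx.2.trans_le hle)),
      sub_zero, sub_zero, ν.abs_altJump]
  -- One `τ` is left by the incomplete merge, the other by the additional jump.
  have hR' : ∀ x ∉ Set.Ico (ν.extLoc i.castSucc) (ν.extLoc i.succ),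
      |ν.compress.f x - ν'.f x| ≤ 2 * τ := by
    intro x hx
    rw [hdiff]
    by_cases hx1 : ν.extLoc i.castSucc ≤ x
    · have hx2 : ν.extLoc i.succ ≤ x := not_lt.1 fun h => hx ⟨hx1, h⟩
      rw [if_pos hx1, if_pos hx2, sub_sub_cancel]
      refine (abs_sub _ _).trans ?_
      rw [hsgn]
      split_ifs
      · rw [hsgn]
        linarith
      · rw [abs_zero]
        linarith
    · have hx2 : ¬ ν.extLoc i.succ ≤ x := fun h => hx1 (hlt.le.trans h)
      rw [if_neg hx1, if_neg hx2, if_neg fun h => hx2 (hle.trans h)]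
      simp [hτ0.le]
  obtain ⟨l, hl⟩ : ∃ l : Fin m, (l : ℕ) + 1 = m := ⟨⟨m - 1, by have := i.2; omega⟩, by
    have := i.2
    simp only
    omega⟩
  -- The last change point is below `5/8` in one environment and at `15/16` in the other, and `5/16
  -- > 2η`.
  have hfar : 2 * η < |ν.compress.loc l - ν'.loc l| := by
    have e : ν'.loc l = 15 / 16 := by
      have : i.castSucc.succAbove l = Fin.last m := by
        rw [Fin.succAbove_of_le_castSucc _ _ (by
          rw [Fin.castSucc_le_castSucc_iff, Fin.le_def]
          have := i.2
          omega)]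
        exact Fin.ext (by simpa using hl)
      rw [hν', Environment.merge, Environment.ofGaussian_loc, this, ν.extLoc_last]
    rw [e, ν.compress_loc, abs_sub_comm]
    refine lt_of_lt_of_le ?_ (le_abs_self _)
    linarith [(ν.loc_mem l).2]
  have hQ := π.law_answerSet_le hπ ν' rfl n hfar
  -- The event has probability at least `1 - 2δ` under one signal and at most `δ` under the other;
  -- with `a = log (1/δ)` the logarithm is at most `log (2 - δ)`.
  have key := π.mul_law_le_log ν.compress.measurable_f ν'.measurable_f n measurableSet_Ico hR hR'
    (Real.log (1 / δ)) (π.measurableSet_answerSet n η ν.compress.loc)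
  have hδinv : 1 < 1 / δ := by rw [lt_div_iff₀ hδ0]; linarith
  rw [Real.exp_log (by positivity)] at key
  have hlog0 : 0 ≤ Real.log (1 / δ) := Real.log_nonneg hδinv.le
  have hQ0 : 0 ≤ (π.law ν'.f n).real (π.answerSet n η ν.compress.loc) := measureReal_nonneg
  have hlog : Real.log (1 + (1 / δ - 1) * (π.law ν'.f n).real (π.answerSet n η ν.compress.loc)) ≤
      Real.log 2 := by
    refine Real.log_le_log ?_ ?_
    · have := mul_nonneg (sub_nonneg.2 hδinv.le) hQ0
      linarith
    · have h3 := mul_le_mul_of_nonneg_left hQ (sub_nonneg.2 hδinv.le)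
      have h4 : (1 / δ - 1) * δ = 1 - δ := by field_simp
      linarith
  have hn : (n : ℝ) * ((2 * τ) ^ 2 / 2) ≤ 1 / 4 := by
    have hn0 : (0 : ℝ) < n + 1 := by positivity
    have h5 : τ * (4 * (n + 1)) < 1 := (lt_div_iff₀ (by positivity)).1 hτn
    have h6 : τ * (n + 1) ≤ 1 / 4 := by linarith
    have h7 : τ ≤ 1 / 4 := by nlinarith [mul_nonneg hτ0.le (Nat.cast_nonneg (α := ℝ) n)]
    nlinarith [mul_le_mul h6 h7 hτ0.le (by norm_num)]
  have hmargin := log_one_div_eight_mul_add_le hδ0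
  have hP := mul_le_mul_of_nonneg_left h hlog0
  rw [sq_abs] at key
  have hsq := ν.sq_jump_pos i
  have hfin : Real.log (1 / (8 * δ)) ≤ ν.jump i ^ 2 / 2 *
      π.visits ν.compress.f n (Set.Ico (ν.extLoc i.castSucc) (ν.extLoc i.succ)) := by
    linarith
  calc 2 * (1 / ν.jump i ^ 2) * Real.log (1 / (8 * δ)) ≤ 2 * (1 / ν.jump i ^ 2) *
        (ν.jump i ^ 2 / 2 *
      π.visits ν.compress.f n (Set.Ico (ν.extLoc i.castSucc) (ν.extLoc i.succ))) :=
        mul_le_mul_of_nonneg_left hfin (by positivity)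
    _ = _ := by
      have := ν.jump_ne_zero i
      field_simp

/-- The number of queries needed for the confidence level. -/
theorem two_mul_hLocalize_mul_log_le (π : Algorithm.{u} m) {δ η : ℝ}
    (hδ : δ ∈ Set.Ioo (0 : ℝ) (1 / 8)) (hη : η < 1 / 8) (hπ : π.IsCorrect δ η)
    (ν : Environment m) (n : ℕ)
    (h : 1 - 2 * δ ≤ (π.law ν.compress.f n).real (π.answerSet n η ν.compress.loc)) :
    2 * ν.hLocalize m * Real.log (1 / (8 * δ)) ≤ n := by
  rw [ν.hLocalize_eq, Finset.mul_sum, Finset.sum_mul]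
  refine (Finset.sum_le_sum fun i _ => π.le_visits_of_correct hδ hη hπ ν n h i).trans ?_
  refine π.sum_visits_le ν.compress.measurable_f n _ (fun _ _ => measurableSet_Ico)
    (fun i _ j _ hij => ?_)
  have aux : ∀ i j : Fin m, i < j → ν.extLoc i.succ ≤ ν.extLoc j.castSucc := fun i j h =>
    ν.strictMono_extLoc.monotone (Fin.succ_le_castSucc_iff.2 h)
  rcases lt_or_gt_of_ne hij with h | h
  · exact Set.disjoint_left.2 fun x hx hy => by linarith [hx.2, hy.1, aux i j h]
  · exact Set.disjoint_left.2 fun x hx hy => by linarith [hx.1, hy.2, aux j i h]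

end Algorithm

/-! ### Replacing two neighbouring change points by a bump. -/

namespace Environment

variable {m : ℕ}

/-- The change points when the `a`-th and `b`-th are replaced by the ends of a bump `[p, p + r)`. -/
def bumpLoc (ν : Environment m) (a b : Fin m) (p r : ℝ) (i : Fin m) : ℝ :=
  if i < a then ν.loc i / 4 else if i = a then p else if i = b then p + r
  else 3 / 4 + ν.loc i / 4

/-- The jumps when the `a`-th and `b`-th are replaced by those of a bump of height `d`. -/
def bumpJump (ν : Environment m) (a b : Fin m) (d : ℝ) (i : Fin m) : ℝ :=
  if i = a then d else if i = b then -d else ν.jump i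

/-- Admissible positions and widths of the bump. -/
structure BumpFits (ν : Environment m) (a b : Fin m) (p r : ℝ) : Prop where
  succ : (b : ℕ) = a + 1
  width_pos : 0 < r
  width_le : r ≤ (ν.loc b - ν.loc a) / 4
  le_left : ν.loc a / 4 + r ≤ p
  right_le : p + r ≤ 3 / 4 + ν.loc a / 4

namespace BumpFits

variable {ν : Environment m} {a b : Fin m} {p r : ℝ}

theorem lt (h : BumpFits ν a b p r) : a < b := Fin.lt_def.2 (by have := h.succ; omega)

theorem _root_.Environment.bumpLoc_left (ν : Environment m) (a b : Fin m) (p r : ℝ) :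
    ν.bumpLoc a b p r a = p := by simp [bumpLoc]

theorem bumpLoc_right (h : BumpFits ν a b p r) : ν.bumpLoc a b p r b = p + r := by
  simp [bumpLoc, h.lt.not_gt, h.lt.ne']

theorem _root_.Environment.bumpLoc_of_lt (ν : Environment m) {a i : Fin m} (b : Fin m) (p r : ℝ)
    (hi : i < a) :
    ν.bumpLoc a b p r i = ν.loc i / 4 := by simp [bumpLoc, hi]

theorem bumpLoc_of_gt (h : BumpFits ν a b p r) {i : Fin m} (hi : b < i) :
    ν.bumpLoc a b p r i = 3 / 4 + ν.loc i / 4 := by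
  simp [bumpLoc, (h.lt.trans hi).not_gt, (h.lt.trans hi).ne', hi.ne']

theorem cases (h : BumpFits ν a b p r) (i : Fin m) : i < a ∨ i = a ∨ i = b ∨ b < i := by
  have := h.succ
  simp only [Fin.lt_def, Fin.ext_iff]
  omega

/-- Points on either side are contracted by `1/4` towards the ends of `[0, 1]`, and the gaps next to
the bump only gain. The excluded case `i = a` is the width of the bump. -/
theorem sub_ge (h : BumpFits ν a b p r) {i j : Fin m} (hij : (j : ℕ) = i + 1) (hi : i ≠ a) :
    (ν.loc j - ν.loc i) / 4 ≤ ν.bumpLoc a b p r j - ν.bumpLoc a b p r i := by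
  have hx := ν.loc_strictMono (Fin.lt_def.2 (by omega : (i : ℕ) < j))
  have hab := ν.loc_strictMono h.lt
  have h0 := h.width_pos
  have h2 := h.le_left
  have h3 := h.right_le
  have hs := h.succ
  rcases h.cases i with hi' | rfl | rfl | hi'
  · have hj : j < a ∨ j = a := by
      rw [← le_iff_lt_or_eq, Fin.le_def, hij]
      exact hi'
    rcases hj with hj | rfl
    · rw [ν.bumpLoc_of_lt b p r hi', ν.bumpLoc_of_lt b p r hj]
      linarith
    · rw [ν.bumpLoc_of_lt b p r hi', ν.bumpLoc_left]
      linarith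
  · exact absurd rfl hi
  · rw [h.bumpLoc_right, h.bumpLoc_of_gt (Fin.lt_def.2 (by omega))]
    linarith
  · rw [h.bumpLoc_of_gt hi', h.bumpLoc_of_gt (hi'.trans (Fin.lt_def.2 (by omega)))]
    linarith

theorem width_le_sub (h : BumpFits ν a b p r) {i j : Fin m} (hij : (j : ℕ) = i + 1)
    (hi : i = a ∨ i = b ∨ j = a) : r ≤ ν.bumpLoc a b p r j - ν.bumpLoc a b p r i := by
  have hab := ν.loc_strictMono h.lt
  have h1 := h.width_le
  have h2 := h.le_left
  have h3 := h.right_le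
  have hs := h.succ
  have hx := ν.loc_strictMono (Fin.lt_def.2 (by omega : (i : ℕ) < j))
  rcases hi with rfl | rfl | rfl
  · have : j = b := Fin.ext (by omega)
    rw [this, h.bumpLoc_right, ν.bumpLoc_left]
    linarith
  · rw [h.bumpLoc_right, h.bumpLoc_of_gt (Fin.lt_def.2 (by omega))]
    linarith
  · rw [ν.bumpLoc_left, ν.bumpLoc_of_lt b p r (Fin.lt_def.2 (by omega))]
    linarith

theorem strictMono_bumpLoc (h : BumpFits ν a b p r) : StrictMono (ν.bumpLoc a b p r) := by
  have key : ∀ i j : Fin m, (j : ℕ) = i + 1 → ν.bumpLoc a b p r i < ν.bumpLoc a b p r j := by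
    intro i j hij
    by_cases hi : i = a
    · linarith [h.width_le_sub hij (Or.inl hi), h.width_pos]
    · linarith [h.sub_ge hij hi, ν.loc_strictMono (Fin.lt_def.2 (by omega : (i : ℕ) < j))]
  cases m with
  | zero => exact fun i => i.elim0
  | succ k => exact Fin.strictMono_iff_lt_succ.2 fun i => key _ _ (by simp)

theorem bumpLoc_mem (h : BumpFits ν a b p r) (i : Fin m) :
    ν.bumpLoc a b p r i ∈ Set.Ioo (0 : ℝ) 1 := by
  have h0 := h.width_pos
  have h2 := h.le_left
  have h3 := h.right_le
  have ha := ν.loc_mem a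
  have hi' := ν.loc_mem i
  rw [Set.mem_Ioo] at *
  rcases h.cases i with hi | rfl | rfl | hi
  · rw [ν.bumpLoc_of_lt b p r hi]; constructor <;> linarith
  · rw [ν.bumpLoc_left]; constructor <;> linarith
  · rw [h.bumpLoc_right]; constructor <;> linarith
  · rw [h.bumpLoc_of_gt hi]; constructor <;> linarith

end BumpFits

variable {a b : Fin m} {p r d : ℝ}

/-- The environment in which the change points `a` and `b` are replaced by the ends of a bump. -/
def bump (ν : Environment m) (h : BumpFits ν a b p r) (hd : 0 < d) (hd1 : d ≤ 1) :
    Environment m :=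
  ofGaussian (ν.bumpLoc a b p r) (ν.bumpJump a b d) h.strictMono_bumpLoc h.bumpLoc_mem
    (fun i => by
      unfold bumpJump
      split_ifs
      · exact hd.ne'
      · exact neg_ne_zero.2 hd.ne'
      · exact ν.jump_ne_zero i)
    (fun i => by
      unfold bumpJump
      split_ifs
      · rwa [abs_of_pos hd]
      · rwa [abs_neg, abs_of_pos hd]
      · exact ν.abs_jump_le_one i)

/-- The signal without the bump. -/
def flat (ν : Environment m) (a b : Fin m) (x : ℝ) : ℝ :=
  ∑ i, if (if i < a then ν.loc i / 4 else 3 / 4 + ν.loc i / 4) ≤ x then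
    (if i = a then 0 else if i = b then 0 else ν.jump i) else 0

theorem measurable_flat (ν : Environment m) (a b : Fin m) : Measurable (ν.flat a b) := by
  unfold flat
  exact Finset.measurable_sum _ fun i _ =>
    Measurable.ite measurableSet_Ici measurable_const measurable_const

theorem bump_f (ν : Environment m) (h : BumpFits ν a b p r) (hd : 0 < d) (hd1 : d ≤ 1) (x : ℝ) :
    (ν.bump h hd hd1).f x =
      ν.flat a b x + (if p ≤ x then d else 0) + (if p + r ≤ x then -d else 0) := by
  have e : (ν.bump h hd hd1).f x =
      ∑ i, if ν.bumpLoc a b p r i ≤ x then ν.bumpJump a b d i else 0 := zero_add _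
  have e1 : ∀ i, (if ν.bumpLoc a b p r i ≤ x then ν.bumpJump a b d i else 0) =
      (if (if i < a then ν.loc i / 4 else 3 / 4 + ν.loc i / 4) ≤ x then
        (if i = a then 0 else if i = b then 0 else ν.jump i) else 0) +
      (if i = a then (if p ≤ x then d else 0) else 0) +
      (if i = b then (if p + r ≤ x then -d else 0) else 0) := by
    intro i
    by_cases hia : i = a
    · subst hia
      simp [ν.bumpLoc_left, bumpJump, h.lt.ne]
    · by_cases hib : i = b
      · subst hib
        simp [h.bumpLoc_right, bumpJump, h.lt.ne']
      · simp [bumpLoc, bumpJump, hia, hib]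
  rw [e, Finset.sum_congr rfl fun i _ => e1 i, Finset.sum_add_distrib, Finset.sum_add_distrib,
    Finset.sum_ite_eq', Finset.sum_ite_eq', if_pos (Finset.mem_univ _), if_pos (Finset.mem_univ _)]
  rfl

theorem abs_flat_sub_bump_f_of_mem (ν : Environment m) (h : BumpFits ν a b p r) (hd : 0 < d)
    (hd1 : d ≤ 1) {x : ℝ} (hx : x ∈ Set.Ico p (p + r)) :
    |ν.flat a b x - (ν.bump h hd hd1).f x| ≤ d := by
  rw [bump_f, if_pos hx.1, if_neg (not_le.2 hx.2), add_zero, sub_add_cancel_left, abs_neg,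
    abs_of_pos hd]

theorem abs_flat_sub_bump_f_of_notMem (ν : Environment m) (h : BumpFits ν a b p r) (hd : 0 < d)
    (hd1 : d ≤ 1) {x : ℝ} (hx : x ∉ Set.Ico p (p + r)) :
    |ν.flat a b x - (ν.bump h hd hd1).f x| ≤ 0 := by
  have h0 := h.width_pos
  rw [bump_f]
  by_cases hp : p ≤ x
  · have : p + r ≤ x := not_lt.1 fun h' => hx ⟨hp, h'⟩
    simp [hp, this]
  · have : ¬ p + r ≤ x := fun h' => hp (by linarith)
    simp [hp, this]

/-- By `hH`, `d ^ 2` is the harmonic mean of the two replaced squared jumps. -/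
theorem bump_hLocalize (ν : Environment m) (h : BumpFits ν a b p r) (hd : 0 < d) (hd1 : d ≤ 1)
    (hH : 2 / d ^ 2 = 1 / ν.jump a ^ 2 + 1 / ν.jump b ^ 2) :
    (ν.bump h hd hd1).hLocalize m = ν.hLocalize m := by
  rw [hLocalize_eq, hLocalize_eq]
  have e1 : ∀ i, 1 / (ν.bump h hd hd1).jump i ^ 2 = 1 / ν.jump i ^ 2 +
      (if i = a then 1 / d ^ 2 - 1 / ν.jump a ^ 2 else 0) +
      (if i = b then 1 / d ^ 2 - 1 / ν.jump b ^ 2 else 0) := by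
    intro i
    change 1 / ν.bumpJump a b d i ^ 2 = _
    by_cases hia : i = a
    · subst hia
      simp [bumpJump, h.lt.ne]
    · by_cases hib : i = b
      · subst hib
        simp [bumpJump, h.lt.ne']
      · simp [bumpJump, hia, hib]
  rw [Finset.sum_congr rfl fun i _ => e1 i, Finset.sum_add_distrib, Finset.sum_add_distrib,
    Finset.sum_ite_eq', Finset.sum_ite_eq', if_pos (Finset.mem_univ _), if_pos (Finset.mem_univ _)]
  have : 2 / d ^ 2 = 1 / d ^ 2 + 1 / d ^ 2 := by ring
  linarith

/-- By `hr`, the bump has a quarter of the minimal energy of `ν`. Its ends have spacing at least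
`r`, and other change points keep their jump and at least a quarter of their spacing. -/
theorem comparable_bump (ν : Environment m) (h : BumpFits ν a b p r) (hd : 0 < d) (hd1 : d ≤ 1)
    (hH : 2 / d ^ 2 = 1 / ν.jump a ^ 2 + 1 / ν.jump b ^ 2)
    (hr : r * d ^ 2 = 1 / (4 * ν.hDetect)) : Comparable ν (ν.bump h hd hd1) := by
  have hm : 1 ≤ m := by have := a.2; omega
  have hr0 := h.width_pos
  have hr1 : r ≤ 1 := by linarith [h.width_le, (ν.loc_mem a).1, (ν.loc_mem b).2]
  have hl := ν.bump_hLocalize h hd hd1 hH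
  have hd2 : (0 : ℝ) < d ^ 2 := by positivity
  have hloc : ∀ i, (ν.bump h hd hd1).loc i = ν.bumpLoc a b p r i := fun i => rfl
  have hjump : ∀ i, (ν.bump h hd hd1).jump i = ν.bumpJump a b d i := fun i => rfl
  obtain ⟨k, hk, hmin⟩ := ν.exists_hDetect_eq hm
  have hk0 := ν.energySq_pos k
  have hr' : r * d ^ 2 = ν.energySq k / 4 := by
    rw [hr, hk]
    field_simp
  refine ⟨?_, ?_, by linarith [ν.hLocalize_nonneg], hl.le⟩
  · rw [hk]
    refine le_trans (one_div_le_one_div_of_le ((ν.bump h hd hd1).energySq_pos a) ?_)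
      ((ν.bump h hd hd1).le_hDetect a)
    have hs := (ν.bump h hd hd1).spacing_le_right h.succ
    rw [hloc, hloc, ν.bumpLoc_left, h.bumpLoc_right] at hs
    have : (ν.bump h hd hd1).jump a = d := by rw [hjump]; simp [bumpJump]
    rw [energySq, this]
    have := mul_le_mul_of_nonneg_right hs hd2.le
    linarith
  · have key : ∀ i, ν.energySq k / 4 ≤ (ν.bump h hd hd1).energySq i := by
      intro i
      by_cases hi : i = a ∨ i = b
      · have hs : r ≤ (ν.bump h hd hd1).spacing i := by
          refine le_spacing _ hr1 (fun j hj => ?_) (fun j hj => ?_)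
          · rw [hloc, hloc]
            refine h.width_le_sub hj ?_
            rcases hi with rfl | rfl
            · exact Or.inr (Or.inr rfl)
            · exact Or.inl (Fin.ext (by have := h.succ; omega))
          · rw [hloc, hloc]
            refine h.width_le_sub hj ?_
            rcases hi with rfl | rfl
            · exact Or.inl rfl
            · exact Or.inr (Or.inl rfl)
        have hj : (ν.bump h hd hd1).jump i ^ 2 = d ^ 2 := by
          rw [hjump]
          rcases hi with rfl | rfl
          · simp [bumpJump]
          · simp [bumpJump, h.lt.ne']
        rw [← hr', energySq, hj]
        exact mul_le_mul_of_nonneg_right hs hd2.le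
      · rw [not_or] at hi
        have hs : ν.spacing i / 4 ≤ (ν.bump h hd hd1).spacing i := by
          refine le_spacing _ (by linarith [ν.spacing_le_one i]) (fun j hj => ?_) (fun j hj => ?_)
          · have hja : j ≠ a := fun e => hi.2 (Fin.ext (by have := h.succ; rw [hj, e]; omega))
            rw [hloc, hloc]
            linarith [h.sub_ge hj hja, ν.spacing_le_left hj]
          · rw [hloc, hloc]
            linarith [h.sub_ge hj hi.1, ν.spacing_le_right hj]
        have hj : (ν.bump h hd hd1).jump i = ν.jump i := by
          rw [hjump]
          simp [bumpJump, hi.1, hi.2]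
        have h3 := hmin i
        have h4 := mul_le_mul_of_nonneg_right hs (sq_nonneg (ν.jump i))
        have e : (ν.bump h hd hd1).energySq i =
            (ν.bump h hd hd1).spacing i * ν.jump i ^ 2 := by rw [energySq, hj]
        have e' : ν.energySq i = ν.spacing i * ν.jump i ^ 2 := rfl
        linarith
    refine ((ν.bump h hd hd1).hDetect_le hm (by linarith) key).trans_eq ?_
    rw [hk, one_div_div]
    ring

end Environment

/-! ### Queries needed for detection. -/

namespace Algorithm

variable {m : ℕ}

/-- Within `n` observations, `π` answers correctly with probability at least `1 - 2 * δ` in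
every Gaussian environment that is comparable to `ν`. -/
def SolvesComparable (π : Algorithm.{u} m) (ν : Environment m) (δ η : ℝ) (n : ℕ) : Prop :=
  ∀ ν' : Environment m, ν'.noise = gaussianReal 0 1 → Environment.Comparable ν ν' →
    1 - 2 * δ ≤ (π.law ν'.f n).real (π.answerSet n η ν'.loc)

theorem le_visits_bump (π : Algorithm.{u} m) {δ η : ℝ} (hδ : δ ∈ Set.Ioo (0 : ℝ) (1 / 8))
    {ν : Environment m} {n : ℕ} (h : π.SolvesComparable ν δ η n) {a b : Fin m} {p r d : ℝ}
    (hb : Environment.BumpFits ν a b p r) (hd : 0 < d) (hd1 : d ≤ 1)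
    (hH : 2 / d ^ 2 = 1 / ν.jump a ^ 2 + 1 / ν.jump b ^ 2)
    (hr : r * d ^ 2 = 1 / (4 * ν.hDetect)) :
    (1 - (π.law (ν.flat a b) n).real (π.answerSet n η (ν.bumpLoc a b p r))) *
        Real.log (1 / (2 * δ)) - Real.log 2 ≤
      d ^ 2 / 2 * π.visits (ν.flat a b) n (Set.Ico p (p + r)) := by
  obtain ⟨hδ0, hδ1⟩ := hδ
  set ν' := ν.bump hb hd hd1 with hν'
  have hfl := ν.measurable_flat a b
  have := π.isProbabilityMeasure_law hfl n
  have := π.isProbabilityMeasure_law ν'.measurable_f n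
  have hP := h ν' rfl (ν.comparable_bump hb hd hd1 hH hr)
  have hS := π.measurableSet_answerSet n η (ν.bumpLoc a b p r)
  have hloc : ν'.loc = ν.bumpLoc a b p r := rfl
  rw [hloc] at hP
  -- The event is a wrong or missing answer, of probability at most `2δ` with the bump; visits are
  -- counted without it.
  have key := π.mul_law_le_log hfl ν'.measurable_f n measurableSet_Ico
    (fun x hx => ν.abs_flat_sub_bump_f_of_mem hb hd hd1 hx)
    (fun x hx => ν.abs_flat_sub_bump_f_of_notMem hb hd hd1 hx)
    (Real.log (1 / (2 * δ))) hS.compl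
  have hinv : 1 < 1 / (2 * δ) := by rw [lt_div_iff₀ (by linarith)]; linarith
  rw [Real.exp_log (by positivity), probReal_compl_eq_one_sub hS,
    probReal_compl_eq_one_sub hS] at key
  have hQ1 : (π.law ν'.f n).real (π.answerSet n η (ν.bumpLoc a b p r)) ≤ 1 := measureReal_le_one
  have hlog : Real.log (1 + (1 / (2 * δ) - 1) *
      (1 - (π.law ν'.f n).real (π.answerSet n η (ν.bumpLoc a b p r)))) ≤ Real.log 2 := by
    refine Real.log_le_log ?_ ?_
    · have := mul_nonneg (sub_nonneg.2 hinv.le) (sub_nonneg.2 hQ1)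
      linarith
    · have h3 := mul_le_mul_of_nonneg_left (by linarith : 1 - (π.law ν'.f n).real
        (π.answerSet n η (ν.bumpLoc a b p r)) ≤ 2 * δ) (sub_nonneg.2 hinv.le)
      have h4 : (1 / (2 * δ) - 1) * (2 * δ) = 1 - 2 * δ := by field_simp
      linarith
  have h0 : (n : ℝ) * ((0 : ℝ) ^ 2 / 2) = 0 := by simp
  linarith

/-- The number of queries needed to find a bump among many possible positions. -/
theorem mul_log_le_of_bump (π : Algorithm.{u} m) {δ η : ℝ} (hδ : δ ∈ Set.Ioo (0 : ℝ) (1 / 8))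
    (hη : η < 1 / 8) {ν : Environment m} {n : ℕ} (h : π.SolvesComparable ν δ η n)
    {a b : Fin m} {r d : ℝ} (hab : (b : ℕ) = a + 1) (hr0 : 0 < r)
    (hr1 : r ≤ (ν.loc b - ν.loc a) / 4) (hd : 0 < d) (hd1 : d ≤ 1)
    (hH : 2 / d ^ 2 = 1 / ν.jump a ^ 2 + 1 / ν.jump b ^ 2)
    (hr : r * d ^ 2 = 1 / (4 * ν.hDetect)) (K : ℕ) (hK : (K + 1) * r ≤ 3 / 8) :
    2 * K / d ^ 2 * Real.log (1 / (8 * δ)) ≤ n := by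
  -- Two rows of `K` disjoint intervals, `3/8` apart, in the free stretch of length `3/4`. The shift
  -- `3/8 > 2η` makes paired positions incompatible as answers.
  set P : ℕ × Bool → ℝ := fun q => ν.loc a / 4 + (q.1 + 1) * r + if q.2 then 3 / 8 else 0 with hPdef
  set I := Finset.range K ×ˢ (Finset.univ : Finset Bool) with hI
  have hfits : ∀ q ∈ I, Environment.BumpFits ν a b (P q) r := by
    rintro ⟨t, β⟩ hq
    have ht : (t : ℝ) + 1 ≤ K := by
      have := Finset.mem_range.1 (Finset.mem_product.1 hq).1
      exact_mod_cast this
    have h1 := mul_le_mul_of_nonneg_right ht hr0.le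
    have h2 : 0 ≤ (t : ℝ) * r := by positivity
    have h3 : 0 ≤ (if β then (3 / 8 : ℝ) else 0) ∧ (if β then (3 / 8 : ℝ) else 0) ≤ 3 / 8 := by
      split_ifs <;> norm_num
    refine ⟨hab, hr0, hr1, ?_, ?_⟩
    · simp only [hPdef]
      linarith [h3.1]
    · simp only [hPdef]
      linarith [h3.2]
  have hdisj : ((I : Finset (ℕ × Bool)) : Set (ℕ × Bool)).PairwiseDisjoint
      fun q => Set.Ico (P q) (P q + r) := by
    have hlt : ∀ t t' : ℕ, t < t' → (t + 1 : ℝ) * r + r ≤ (t' + 1) * r := fun t t' htt => by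
      have : (t : ℝ) + 1 ≤ t' := by exact_mod_cast htt
      nlinarith
    have hbd : ∀ t β, (t, β) ∈ I → (t + 1 : ℝ) * r + r ≤ 3 / 8 := fun t β hq => by
      have : (t : ℝ) + 1 ≤ K := by
        have := Finset.mem_range.1 (Finset.mem_product.1 hq).1
        exact_mod_cast this
      nlinarith
    rintro ⟨t, β⟩ hq ⟨t', β'⟩ hq' hne
    have b1 := hbd t β hq
    have b2 := hbd t' β' hq'
    have p1 : 0 ≤ (t + 1 : ℝ) * r := by positivity
    have p2 : 0 ≤ (t' + 1 : ℝ) * r := by positivity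
    refine Set.disjoint_left.2 fun x hx hx' => ?_
    simp only [hPdef, Set.mem_Ico] at hx hx'
    by_cases hβ : β = β'
    · subst hβ
      have htt : t ≠ t' := fun e => hne (by rw [e])
      rcases lt_or_gt_of_ne htt with h' | h'
      · linarith [hlt _ _ h', hx.2, hx'.1]
      · linarith [hlt _ _ h', hx.1, hx'.2]
    · cases β <;> cases β' <;> simp at hβ hx hx' <;> linarith [hx.1, hx.2, hx'.1, hx'.2]
  have hsum := π.sum_visits_le (ν.measurable_flat a b) n I (fun _ _ => measurableSet_Ico) hdisj
  rw [hI, Finset.sum_product] at hsum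
  have := π.isProbabilityMeasure_law (ν.measurable_flat a b) n
  have hpair : ∀ t ∈ Finset.range K, Real.log (1 / (8 * δ)) ≤ d ^ 2 / 2 *
      ∑ β, π.visits (ν.flat a b) n (Set.Ico (P (t, β)) (P (t, β) + r)) := by
    intro t ht
    have hq : ∀ β, (t, β) ∈ I := fun β => Finset.mem_product.2 ⟨ht, Finset.mem_univ _⟩
    have h1 := π.le_visits_bump hδ h (hfits _ (hq true)) hd hd1 hH hr
    have h2 := π.le_visits_bump hδ h (hfits _ (hq false)) hd hd1 hH hr
    have hfar : 2 * η < |ν.bumpLoc a b (P (t, true)) r a - ν.bumpLoc a b (P (t, false)) r a| := by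
      rw [ν.bumpLoc_left, ν.bumpLoc_left]
      refine lt_of_lt_of_le ?_ (le_abs_self _)
      simp only [hPdef]
      norm_num
      linarith
    -- Without the bump, the two answers have total probability at most `1`, so the two failure
    -- probabilities sum to at least `1`.
    have hD := π.disjoint_answerSet n hfar
    have hU := measureReal_union (μ := π.law (ν.flat a b) n) hD (π.measurableSet_answerSet n η _)
    have hU1 : (π.law (ν.flat a b) n).real (π.answerSet n η (ν.bumpLoc a b (P (t, true)) r) ∪
      π.answerSet n η (ν.bumpLoc a b (P (t, false)) r)) ≤ 1 := measureReal_le_one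
    rw [hU] at hU1
    rw [Fintype.sum_bool, mul_add]
    have hinv : 1 < 1 / (2 * δ) := by
      rw [lt_div_iff₀ (by linarith [hδ.1])]
      linarith [hδ.2]
    have hl0 := Real.log_nonneg hinv.le
    have hl : Real.log (1 / (8 * δ)) = Real.log (1 / (2 * δ)) - 2 * Real.log 2 := by
      have e : (1 : ℝ) / (8 * δ) = 1 / (2 * δ) / (2 ^ 2) := by field_simp; norm_num
      rw [e, Real.log_div (by positivity) (by norm_num), Real.log_pow]
      push_cast
      ring
    have h3 := mul_le_mul_of_nonneg_right hU1 hl0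
    rw [hl]
    linarith
  have htot := Finset.sum_le_sum hpair
  rw [Finset.sum_const, Finset.card_range, nsmul_eq_mul, ← Finset.mul_sum] at htot
  have hd2 : (0 : ℝ) < d ^ 2 := by positivity
  calc 2 * K / d ^ 2 * Real.log (1 / (8 * δ)) =
        2 / d ^ 2 * (K * Real.log (1 / (8 * δ))) := by ring
    _ ≤ 2 / d ^ 2 * (d ^ 2 / 2 * ∑ t ∈ Finset.range K, ∑ β,
        π.visits (ν.flat a b) n (Set.Ico (P (t, β)) (P (t, β) + r))) :=
        mul_le_mul_of_nonneg_left htot (by positivity)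
    _ = ∑ t ∈ Finset.range K, ∑ β,
        π.visits (ν.flat a b) n (Set.Ico (P (t, β)) (P (t, β) + r)) := by field_simp
    _ ≤ n := hsum

/-- The number of queries needed for detection. -/
theorem half_mul_hDetect_mul_log_le (π : Algorithm.{u} m) (hm : 1 ≤ m) {δ η : ℝ}
    (hδ : δ ∈ Set.Ioo (0 : ℝ) (1 / 8)) (hη : η < 1 / 8) (hπ : π.IsCorrect δ η)
    {ν : Environment m} {n : ℕ} (h : π.SolvesComparable ν δ η n) :
    1 / 2 * ν.hDetect * Real.log (1 / (8 * δ)) ≤ n := by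
  have hL : 0 ≤ Real.log (1 / (8 * δ)) := Real.log_nonneg (by
    rw [le_div_iff₀ (by linarith [hδ.1])]
    linarith [hδ.2])
  obtain ⟨k, hk, hmin⟩ := ν.exists_hDetect_eq hm
  have hsk := ν.spacing_pos k
  have hjk := ν.sq_jump_pos k
  have hek := ν.energySq_pos k
  have hek' : ν.energySq k = ν.spacing k * ν.jump k ^ 2 := rfl
  -- If the critical spacing is large, `H_detect ≤ 4 / Δ_k² ≤ 4 H_localize`, and the confidence
  -- bound suffices.
  by_cases hs : 1 / 4 ≤ ν.spacing k
  · have h1 := π.two_mul_hLocalize_mul_log_le hδ hη hπ ν n (h _ rfl (ν.comparable_perturb hm _ _ _))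
    have h2 : 1 / ν.jump k ^ 2 ≤ ν.hLocalize m := by
      rw [ν.hLocalize_eq]
      exact Finset.single_le_sum (f := fun i => 1 / ν.jump i ^ 2)
        (fun i _ => by positivity) (Finset.mem_univ k)
    have h3 : ν.hDetect ≤ 4 * (1 / ν.jump k ^ 2) := by
      rw [hk, hek', mul_one_div, div_le_div_iff₀ (by positivity) hjk]
      nlinarith
    refine le_trans (mul_le_mul_of_nonneg_right ?_ hL) h1
    linarith
  · obtain ⟨a, b, hab, hk', hsab⟩ := ν.exists_adjacent (i := k) (by linarith)
    have hja := ν.sq_jump_pos a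
    have hjb := ν.sq_jump_pos b
    -- The spacings of `a` and `b` are at most that of `k`, and their energies at least that of `k`.
    have hlow : ν.jump k ^ 2 ≤ ν.jump a ^ 2 ∧ ν.jump k ^ 2 ≤ ν.jump b ^ 2 := by
      have ha := hmin a
      have hb := hmin b
      have ha' : ν.energySq a = ν.spacing a * ν.jump a ^ 2 := rfl
      have hb' : ν.energySq b = ν.spacing b * ν.jump b ^ 2 := rfl
      have sa := mul_le_mul_of_nonneg_right (ν.spacing_le_right hab) hja.le
      have sb := mul_le_mul_of_nonneg_right (ν.spacing_le_left hab) hjb.le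
      rw [← hsab] at sa sb
      exact ⟨le_of_mul_le_mul_left (by linarith) hsk, le_of_mul_le_mul_left (by linarith) hsk⟩
    set v := 2 / (1 / ν.jump a ^ 2 + 1 / ν.jump b ^ 2) with hv
    have hA1 : 1 ≤ 1 / ν.jump a ^ 2 := (one_le_div hja).2 (ν.sq_jump_le_one a)
    have hB1 : 1 ≤ 1 / ν.jump b ^ 2 := (one_le_div hjb).2 (ν.sq_jump_le_one b)
    have hAB : 1 / ν.jump a ^ 2 + 1 / ν.jump b ^ 2 ≤ 2 / ν.jump k ^ 2 := by
      have h1 := one_div_le_one_div_of_le hjk hlow.1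
      have h2 := one_div_le_one_div_of_le hjk hlow.2
      have : 2 / ν.jump k ^ 2 = 1 / ν.jump k ^ 2 + 1 / ν.jump k ^ 2 := by ring
      linarith
    have hv0 : 0 < v := by positivity
    have hv1 : v ≤ 1 := by
      rw [hv, div_le_one (by positivity)]
      linarith
    have hvk : ν.jump k ^ 2 ≤ v := by
      rw [hv, le_div_iff₀ (by positivity), mul_comm]
      exact (le_div_iff₀ hjk).1 hAB
    have hd2 : √v ^ 2 = v := Real.sq_sqrt hv0.le
    set r := ν.energySq k / (4 * v) with hrdef
    have hr0 : 0 < r := by positivity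
    have hrv : r * v = ν.energySq k / 4 := by
      rw [hrdef]
      field_simp
    have hrs : r ≤ ν.spacing k / 4 := by
      rw [hrdef, div_le_div_iff₀ (by positivity) (by norm_num), hek']
      nlinarith
    -- The largest `K` with `(K + 1) r ≤ 3/8`. As `r < 1/16`, it is at least `1 / (16 r)`, and `2 K
    -- / v ≥ 1 / (8 r v) = H_detect / 2`.
    set K := ⌊3 / (8 * r)⌋₊ - 1 with hKdef
    have hfl : (⌊3 / (8 * r)⌋₊ : ℝ) ≤ 3 / (8 * r) := Nat.floor_le (by positivity)
    have hfl' : 3 / (8 * r) < ⌊3 / (8 * r)⌋₊ + 1 := Nat.lt_floor_add_one _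
    have hbig : 2 ≤ 5 / (16 * r) := by
      rw [le_div_iff₀ (by positivity)]
      linarith
    have hsplit : 3 / (8 * r) = 5 / (16 * r) + 1 / (16 * r) := by
      field_simp
      norm_num
    have hone : 1 ≤ ⌊3 / (8 * r)⌋₊ := by
      refine Nat.le_floor ?_
      have : 0 < 1 / (16 * r) := by positivity
      rw [Nat.cast_one]
      linarith
    have hKc : (K : ℝ) + 1 = ⌊3 / (8 * r)⌋₊ := by
      rw [hKdef, Nat.cast_sub hone]
      simp
    have hK : ((K : ℝ) + 1) * r ≤ 3 / 8 := by
      rw [hKc]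
      calc (⌊3 / (8 * r)⌋₊ : ℝ) * r ≤ 3 / (8 * r) * r := mul_le_mul_of_nonneg_right hfl hr0.le
        _ = 3 / 8 := by field_simp
    have hKlow : 1 / (16 * r) ≤ K := by linarith
    have hd1 : √v ≤ 1 := Real.sqrt_le_one.2 hv1
    have hmain := π.mul_log_le_of_bump hδ hη h hab hr0 (by linarith)
      (Real.sqrt_pos.2 hv0) hd1 (by rw [hd2, hv]; field_simp)
      (by rw [hd2, hrv, hk]; field_simp) K hK
    refine le_trans (mul_le_mul_of_nonneg_right ?_ hL) hmain
    rw [hd2, hk]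
    have e : 1 / 2 * (1 / ν.energySq k) = 2 * (1 / (16 * r)) / v := by
      have : ν.energySq k = 4 * (r * v) := by linarith
      rw [this]
      field_simp
      norm_num
    rw [e]
    gcongr

end Algorithm

/-! ### Candidate positions and windows of the change points. -/

/-- A function on a finite product whose sums along the lines in direction `i` are at most `1`. -/
theorem card_mul_sum_pi_le {ι : Type*} [Fintype ι] [DecidableEq ι] {β : ι → Type*}
    [∀ i, Fintype (β i)] (i : ι) (G : (∀ j, β j) → ℝ)
    (h : ∀ ρ, ∑ k, G ((Equiv.piSplitAt i β).symm (k, ρ)) ≤ 1) :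
    Fintype.card (β i) * ∑ κ, G κ ≤ Fintype.card (∀ j, β j) := by
  rw [← Equiv.sum_comp (Equiv.piSplitAt i β).symm, Fintype.sum_prod_type_right,
    Fintype.card_congr (Equiv.piSplitAt i β), Fintype.card_prod]
  push_cast
  refine mul_le_mul_of_nonneg_left ?_ (Nat.cast_nonneg _)
  calc _ ≤ ∑ _ρ : (∀ j : {j // j ≠ i}, β j), (1 : ℝ) := Finset.sum_le_sum fun ρ _ => h ρ
    _ = _ := by simp

/-- The right side is half the logarithm of `K ^ 2 / (4 (K - 1)) ≥ (K + 1) / 4 ≥ (3 r + 1) / 4`, and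
`(3 r + 1) ^ 2 - 16 r = (9 r - 1) (r - 1) ≥ 0`. -/
theorem quarter_log_le {K r : ℝ} (hr : 1 < r) (hK : 3 * r ≤ K) :
    1 / 4 * Real.log r ≤ 1 / 2 * Real.log (K - 1) - Real.log (2 * (K - 1) / K) := by
  have hK1 : 0 < K - 1 := by linarith
  have hK0 : 0 < K := by linarith
  have h1 : r ≤ (K ^ 2 / (4 * (K - 1))) ^ 2 := by
    have h2 : (3 * r + 1) / 4 ≤ K ^ 2 / (4 * (K - 1)) := by
      rw [div_le_div_iff₀ (by norm_num) (by positivity)]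
      nlinarith
    have h3 := pow_le_pow_left₀ (by linarith) h2 2
    nlinarith
  have h2 := Real.log_le_log (by linarith) h1
  have h4 : Real.log 4 = 2 * Real.log 2 := by
    rw [show (4 : ℝ) = 2 ^ 2 by norm_num, Real.log_pow]
    push_cast
    ring
  rw [Real.log_pow, Real.log_div (by positivity) (by positivity), Real.log_pow,
    Real.log_mul (by norm_num) hK1.ne', h4] at h2
  rw [Real.log_div (by positivity) hK0.ne', Real.log_mul (by norm_num) hK1.ne']
  push_cast at h2
  linarith

theorem log_le_log_add_div_sub_one {x c : ℝ} (hx : 0 < x) (hc : 0 < c) :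
    Real.log x ≤ Real.log c + (x / c - 1) := by
  have := Real.log_le_sub_one_of_pos (div_pos hx hc)
  rw [Real.log_div hx.ne' hc.ne'] at this
  linarith

namespace Environment

variable {m : ℕ}

/-- The number of candidate locations of the `i`-th change point. -/
def numShifts (ν : Environment m) (η : ℝ) (i : Fin m) : ℕ := ⌈3 * (ν.spacing i / (16 * η))⌉₊

/-- The candidate shifts of the `i`-th change point, evenly spread over a window of length
`3 / 8 * spacing i`. -/
def shift (ν : Environment m) (η : ℝ) (i : Fin m) (k : Fin (ν.numShifts η i)) : ℝ :=
  3 / 8 * ν.spacing i * (k / (ν.numShifts η i - 1))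

theorem one_le_numShifts (ν : Environment m) {η : ℝ} (hη : 0 < η) (i : Fin m) :
    1 ≤ ν.numShifts η i := by
  have := ν.spacing_pos i
  exact Nat.one_le_ceil_iff.2 (by positivity)

theorem shift_nonneg (ν : Environment m) {η : ℝ} (hη : 0 < η) (i : Fin m)
    (k : Fin (ν.numShifts η i)) : 0 ≤ ν.shift η i k := by
  have h1 := ν.spacing_pos i
  have h2 : (1 : ℝ) ≤ ν.numShifts η i := by exact_mod_cast ν.one_le_numShifts hη i
  exact mul_nonneg (by positivity) (div_nonneg (Nat.cast_nonneg _) (by linarith))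

theorem shift_le (ν : Environment m) {η : ℝ} (hη : 0 < η) (i : Fin m)
    (k : Fin (ν.numShifts η i)) : ν.shift η i k ≤ 3 / 8 * ν.spacing i := by
  have h1 := ν.spacing_pos i
  have h2 : (1 : ℝ) ≤ ν.numShifts η i := by exact_mod_cast ν.one_le_numShifts hη i
  have h3 : (k : ℝ) + 1 ≤ ν.numShifts η i := by exact_mod_cast k.2
  -- With a single candidate the denominator is `0`, and so is the quotient.
  exact mul_le_of_le_one_right (by positivity) (div_le_one_of_le₀ (by linarith) (by linarith))

/-- The mesh is `3 s_i / (8 (K - 1))` for `K` candidates, and rounding up gives `K - 1 < 3 s_i / (16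
η)`. -/
theorem lt_abs_shift_sub (ν : Environment m) {η : ℝ} (hη : 0 < η) (i : Fin m)
    {k l : Fin (ν.numShifts η i)} (hkl : k ≠ l) :
    2 * η < |ν.shift η i k - ν.shift η i l| := by
  have h1 := ν.spacing_pos i
  have h2 : (1 : ℝ) < ν.numShifts η i := by
    have : (k : ℕ) ≠ l := fun h => hkl (Fin.ext h)
    have : 1 < ν.numShifts η i := by have := k.2; have := l.2; omega
    exact_mod_cast this
  have h3 : (1 : ℝ) ≤ |(k : ℝ) - l| := by
    have h4 : (1 : ℤ) ≤ |(k : ℤ) - l| := Int.one_le_abs (sub_ne_zero.2 fun h =>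
      hkl (Fin.ext (by exact_mod_cast h)))
    exact_mod_cast h4
  have h4 : (ν.numShifts η i : ℝ) - 1 < 3 * (ν.spacing i / (16 * η)) := by
    have := Nat.ceil_lt_add_one (a := 3 * (ν.spacing i / (16 * η))) (by positivity)
    have e : ν.numShifts η i = ⌈3 * (ν.spacing i / (16 * η))⌉₊ := rfl
    rw [e]
    linarith
  have h5 : 3 * (ν.spacing i / (16 * η)) * (2 * η) = 3 / 8 * ν.spacing i := by
    field_simp
    norm_num
  have e : ν.shift η i k - ν.shift η i l =
      3 / 8 * ν.spacing i / (ν.numShifts η i - 1) * (k - l) := by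
    unfold shift
    ring
  have h6 : 0 < 3 / 8 * ν.spacing i / (ν.numShifts η i - 1) :=
    div_pos (by positivity) (by linarith)
  rw [e, abs_mul, abs_of_pos h6]
  refine lt_of_lt_of_le ?_ (le_mul_of_one_le_right h6.le h3)
  rw [lt_div_iff₀ (by linarith)]
  nlinarith

/-- The environment with the chosen candidate locations. -/
def shifted (ν : Environment m) {η : ℝ} (hη : 0 < η) (κ : ∀ i, Fin (ν.numShifts η i)) :
    Environment m :=
  ν.perturb (fun i => ν.shift η i (κ i)) (fun i => ν.shift_nonneg hη i _)
    (fun i => ν.shift_le hη i _)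

theorem shifted_f (ν : Environment m) {η : ℝ} (hη : 0 < η) (κ : ∀ i, Fin (ν.numShifts η i))
    (x : ℝ) : (ν.shifted hη κ).f x =
      ∑ j, if 5 / 8 * ν.loc j + ν.shift η j (κ j) ≤ x then ν.altJump j else 0 :=
  zero_add _

/-- The window in which the `i`-th change point is moved. -/
def window (ν : Environment m) (i : Fin m) : Set ℝ :=
  Set.Ico (5 / 8 * ν.loc i) (5 / 8 * ν.loc i + 3 / 8 * ν.spacing i)

/-- The signal whose `i`-th jump is split evenly between the two ends of its window. -/
def splitSignal (ν : Environment m) (η : ℝ) (i : Fin m) (κ : ∀ i, Fin (ν.numShifts η i))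
    (x : ℝ) : ℝ :=
  ∑ j, if j = i then
      (if 5 / 8 * ν.loc i ≤ x then ν.altJump i / 2 else 0) +
      (if 5 / 8 * ν.loc i + 3 / 8 * ν.spacing i ≤ x then ν.altJump i / 2 else 0)
    else if 5 / 8 * ν.loc j + ν.shift η j (κ j) ≤ x then ν.altJump j else 0

theorem splitSignal_congr (ν : Environment m) {η : ℝ} {i : Fin m}
    {κ κ' : ∀ i, Fin (ν.numShifts η i)} (h : ∀ j, j ≠ i → κ j = κ' j) :
    ν.splitSignal η i κ = ν.splitSignal η i κ' := by
  funext x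
  refine Finset.sum_congr rfl fun j _ => ?_
  by_cases hj : j = i
  · rw [if_pos hj, if_pos hj]
  · rw [if_neg hj, if_neg hj, h j hj]

theorem measurable_splitSignal (ν : Environment m) (η : ℝ) (i : Fin m)
    (κ : ∀ i, Fin (ν.numShifts η i)) : Measurable (ν.splitSignal η i κ) := by
  unfold splitSignal
  refine Finset.measurable_sum _ fun j _ => ?_
  split_ifs
  · exact (Measurable.ite measurableSet_Ici measurable_const measurable_const).add
      (Measurable.ite measurableSet_Ici measurable_const measurable_const)
  · exact Measurable.ite measurableSet_Ici measurable_const measurable_const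

theorem shifted_f_sub_splitSignal (ν : Environment m) {η : ℝ} (hη : 0 < η) (i : Fin m)
    (κ : ∀ i, Fin (ν.numShifts η i)) (x : ℝ) :
    (ν.shifted hη κ).f x - ν.splitSignal η i κ x =
      (if 5 / 8 * ν.loc i + ν.shift η i (κ i) ≤ x then ν.altJump i else 0) -
      ((if 5 / 8 * ν.loc i ≤ x then ν.altJump i / 2 else 0) +
      (if 5 / 8 * ν.loc i + 3 / 8 * ν.spacing i ≤ x then ν.altJump i / 2 else 0)) := by
  rw [shifted_f, splitSignal, ← Finset.sum_sub_distrib, Finset.sum_eq_single i]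
  · rw [if_pos rfl]
  · intro j _ hj
    rw [if_neg hj, sub_self]
  · exact fun h => absurd (Finset.mem_univ i) h

/-- In the window the split signal is halfway between the levels before and after the jump, which
divides the divergence per visit by four compared with a full jump. -/
theorem abs_shifted_f_sub_of_mem (ν : Environment m) {η : ℝ} (hη : 0 < η) (i : Fin m)
    (κ : ∀ i, Fin (ν.numShifts η i)) {x : ℝ} (hx : x ∈ ν.window i) :
    |(ν.shifted hη κ).f x - ν.splitSignal η i κ x| ≤ |ν.jump i| / 2 := by
  rw [shifted_f_sub_splitSignal, if_pos hx.1, if_neg (not_le.2 hx.2), add_zero,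
    ← ν.abs_altJump i, show |ν.altJump i| / 2 = |ν.altJump i / 2| by rw [abs_div, abs_two]]
  split_ifs
  · rw [sub_half]
  · rw [zero_sub, abs_neg]

theorem abs_shifted_f_sub_of_notMem (ν : Environment m) {η : ℝ} (hη : 0 < η) (i : Fin m)
    (κ : ∀ i, Fin (ν.numShifts η i)) {x : ℝ} (hx : x ∉ ν.window i) :
    |(ν.shifted hη κ).f x - ν.splitSignal η i κ x| ≤ 0 := by
  have h0 := ν.shift_nonneg hη i (κ i)
  have h1 := ν.shift_le hη i (κ i)
  rw [shifted_f_sub_splitSignal]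
  by_cases h : 5 / 8 * ν.loc i ≤ x
  · have h2 : 5 / 8 * ν.loc i + 3 / 8 * ν.spacing i ≤ x := not_lt.1 fun h' => hx ⟨h, h'⟩
    rw [if_pos (by linarith), if_pos h, if_pos h2]
    simp
  · rw [if_neg (by linarith), if_neg h, if_neg (by linarith)]
    simp

theorem pairwiseDisjoint_window (ν : Environment m) :
    Pairwise (Function.onFun Disjoint ν.window) := by
  have aux : ∀ i j : Fin m, i < j →
      5 / 8 * ν.loc i + 3 / 8 * ν.spacing i < 5 / 8 * ν.loc j := fun i j h =>
    ν.lt_of_loc_add (w := fun i => 3 / 8 * ν.spacing i) (fun _ => le_rfl) h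
  intro i j hij
  refine Set.disjoint_left.2 fun x hx hy => ?_
  rcases lt_or_gt_of_ne hij with h | h
  · linarith [hx.2, hy.1, aux i j h]
  · linarith [hx.1, hy.2, aux j i h]

end Environment

/-! ### Queries needed for accuracy. -/

namespace Algorithm

variable {m : ℕ}

/-- Averaged over the candidate locations, the `i`-th window must be visited often. -/
theorem card_mul_le_sum_visits (π : Algorithm.{u} m) (hm : 1 ≤ m) {δ η : ℝ} (hδ : δ < 1 / 4)
    (hη : 0 < η) {ν : Environment m} {n : ℕ} (h : π.SolvesComparable ν δ η n) (i : Fin m) :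
    (Fintype.card (∀ i, Fin (ν.numShifts η i)) : ℝ) *
        (2 * (1 / ν.jump i ^ 2 * Real.posLog (ν.spacing i / (16 * η)))) ≤
      ∑ κ, π.visits (ν.shifted hη κ).f n (ν.window i) := by
  have hv0 : 0 ≤ ∑ κ, π.visits (ν.shifted hη κ).f n (ν.window i) :=
    Finset.sum_nonneg fun κ _ => π.visits_nonneg _ _ _
  rcases le_or_gt (ν.spacing i / (16 * η)) 1 with hr | hr
  · rw [(Real.posLog_eq_zero_iff _).2 (by
      rwa [abs_of_nonneg (div_nonneg (ν.spacing_pos i).le (by positivity))])]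
    simpa using hv0
  · rw [Real.posLog_eq_log (hr.le.trans (le_abs_self _))]
    set r := ν.spacing i / (16 * η) with hrdef
    set K : ℝ := (ν.numShifts η i : ℝ) with hKdef
    set C : ℝ := (Fintype.card (∀ i, Fin (ν.numShifts η i)) : ℝ) with hC
    have hK : 3 * r ≤ K := Nat.le_ceil _
    have hK0 : 0 < K := by linarith
    have hK1 : 1 < K - 1 := by linarith
    -- The value of `1 + (K - 2) q` at `q = 1 / K`, the bound on the average of `Q`. The logarithm
    -- is replaced by its tangent at `c`, so that it can be averaged.
    set c := 2 * (K - 1) / K with hc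
    have hc0 : 0 < c := by positivity
    set Q : (∀ i, Fin (ν.numShifts η i)) → ℝ := fun κ =>
      (π.law (ν.splitSignal η i κ) n).real (π.answerSet n η (ν.shifted hη κ).loc) with hQ
    -- The split signal does not depend on the `i`-th choice, so for the other choices fixed, the
    -- `K` answers are disjoint events under one law.
    have hline : K * ∑ κ, Q κ ≤ C := by
      have := card_mul_sum_pi_le i Q fun ρ => ?_
      · rwa [Fintype.card_fin] at this
      · set e := (Equiv.piSplitAt i fun i => Fin (ν.numShifts η i)).symm with he
        have hei : ∀ k, e (k, ρ) i = k := fun k => by simp [he, Equiv.piSplitAt]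
        have hej : ∀ k j, (hj : j ≠ i) → e (k, ρ) j = ρ ⟨j, hj⟩ := fun k j hj => by
          simp [he, Equiv.piSplitAt, hj]
        set g := ν.splitSignal η i (e (⟨0, ν.one_le_numShifts hη i⟩, ρ)) with hg
        have hgk : ∀ k, ν.splitSignal η i (e (k, ρ)) = g := fun k =>
          ν.splitSignal_congr fun j hj => by rw [hej _ j hj, hej _ j hj]
        have := π.isProbabilityMeasure_law (ν.measurable_splitSignal η i
          (e (⟨0, ν.one_le_numShifts hη i⟩, ρ))) n
        simp only [hQ, hgk]
        rw [← measureReal_biUnion_finset (fun k _ l _ hkl => ?_)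
          fun k _ => π.measurableSet_answerSet n η _]
        · exact measureReal_le_one
        · refine π.disjoint_answerSet n (l := i) ?_
          rw [Environment.shifted, Environment.shifted, Environment.perturb_loc,
            Environment.perturb_loc, add_sub_add_left_eq_sub, hei, hei]
          exact ν.lt_abs_shift_sub hη i hkl
    have hone : ∀ κ, 1 / 4 * Real.log r ≤ ((1 + (K - 1 - 1) * Q κ) / c - 1) +
        ν.jump i ^ 2 / 8 * π.visits (ν.shifted hη κ).f n (ν.window i) := by
      intro κ
      have hP := h (ν.shifted hη κ) rfl (ν.comparable_perturb hm _ _ _)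
      have key := π.mul_law_le_log (ν.shifted hη κ).measurable_f (ν.measurable_splitSignal η i κ)
        n measurableSet_Ico (fun x hx => ν.abs_shifted_f_sub_of_mem hη i κ hx)
        (fun x hx => ν.abs_shifted_f_sub_of_notMem hη i κ hx)
        (Real.log (K - 1)) (π.measurableSet_answerSet n η (ν.shifted hη κ).loc)
      rw [Real.exp_log (by linarith)] at key
      have hQ0 : 0 ≤ Q κ := measureReal_nonneg
      have hlog := log_le_log_add_div_sub_one
        (x := 1 + (K - 1 - 1) * Q κ) (by nlinarith) hc0
      have hl0 : 0 ≤ Real.log (K - 1) := Real.log_nonneg hK1.le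
      have h1 := mul_le_mul_of_nonneg_left (by linarith : 1 / 2 ≤
        (π.law (ν.shifted hη κ).f n).real (π.answerSet n η (ν.shifted hη κ).loc)) hl0
      have h2 := quarter_log_le hr hK
      have h3 : (|ν.jump i| / 2) ^ 2 / 2 = ν.jump i ^ 2 / 8 := by
        rw [div_pow, sq_abs]
        ring
      have h4 : (n : ℝ) * ((0 : ℝ) ^ 2 / 2) = 0 := by simp
      rw [h3, h4, add_zero] at key
      change _ ≤ Real.log (1 + (K - 1 - 1) * Q κ) + _ * π.visits _ _ (ν.window i) at key
      linarith
    have hsum := Finset.sum_le_sum fun κ (_ : κ ∈ Finset.univ) => hone κ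
    rw [Finset.sum_add_distrib, Finset.sum_sub_distrib, ← Finset.sum_div, Finset.sum_add_distrib,
      ← Finset.mul_sum, ← Finset.mul_sum, Finset.sum_const, Finset.sum_const, Finset.card_univ,
      nsmul_eq_mul, nsmul_eq_mul, ← hC, ← Finset.mul_sum] at hsum
    have hle : (C * 1 + (K - 1 - 1) * ∑ κ, Q κ) / c ≤ C := by
      have h5 : ∑ κ, Q κ ≤ C / K := by
        rw [le_div_iff₀ hK0]
        linarith
      rw [div_le_iff₀ hc0]
      have h6 := mul_le_mul_of_nonneg_left h5 (by linarith : 0 ≤ K - 1 - 1)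
      have h7 : C * 1 + (K - 1 - 1) * (C / K) = C * c := by
        rw [hc]
        field_simp
        ring
      linarith
    have hj := ν.sq_jump_pos i
    have hfin : C * (1 / 4 * Real.log r) ≤
        ν.jump i ^ 2 / 8 * ∑ κ, π.visits (ν.shifted hη κ).f n (ν.window i) := by
      linarith
    have e1 : C * (2 * (1 / ν.jump i ^ 2 * Real.log r)) =
        8 / ν.jump i ^ 2 * (C * (1 / 4 * Real.log r)) := by ring
    rw [e1]
    refine (mul_le_mul_of_nonneg_left hfin (by positivity)).trans_eq ?_
    have := ν.jump_ne_zero i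
    field_simp

/-- The number of queries needed for the accuracy of the estimates. -/
theorem two_mul_sum_posLog_le (π : Algorithm.{u} m) (hm : 1 ≤ m) {δ η : ℝ} (hδ : δ < 1 / 4)
    (hη : 0 < η) {ν : Environment m} {n : ℕ} (h : π.SolvesComparable ν δ η n) :
    2 * ∑ i, 1 / ν.jump i ^ 2 * Real.posLog (ν.spacing i / (16 * η)) ≤ (n : ℝ) := by
  set C : ℝ := (Fintype.card (∀ i, Fin (ν.numShifts η i)) : ℝ) with hC
  have hC0 : 0 < C := by
    have : Nonempty (∀ i, Fin (ν.numShifts η i)) := ⟨fun i => ⟨0, ν.one_le_numShifts hη i⟩⟩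
    rw [hC]
    exact_mod_cast Fintype.card_pos
  refine le_of_mul_le_mul_left ?_ hC0
  rw [Finset.mul_sum, Finset.mul_sum]
  calc _ ≤ ∑ i, ∑ κ, π.visits (ν.shifted hη κ).f n (ν.window i) :=
        Finset.sum_le_sum fun i _ => π.card_mul_le_sum_visits hm hδ hη h i
    _ = ∑ κ, ∑ i, π.visits (ν.shifted hη κ).f n (ν.window i) := Finset.sum_comm
    _ ≤ ∑ κ : (∀ i, Fin (ν.numShifts η i)), (n : ℝ) := Finset.sum_le_sum fun κ _ =>
        π.sum_visits_le (ν.shifted hη κ).measurable_f n _ (fun _ _ => measurableSet_Ico)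
          (fun i _ j _ hij => ν.pairwiseDisjoint_window hij)
    _ = C * n := by simp [hC]

end Algorithm

end

/-! ### Combination of the three bounds. -/

theorem theorem2 (m : ℕ) (hm : 1 ≤ m) (δ η : ℝ) (hδ : δ ∈ Set.Ioo (0 : ℝ) (1 / 4))
    (hη : η ∈ Set.Ioo (0 : ℝ) (1 / 8)) (π : Algorithm.{u} m) (hπ : π.IsCorrect δ η)
    (ν : Environment m) :
    ∃ ν' : Environment m,
      ν.hDetect ≤ ν'.hDetect ∧ ν'.hDetect ≤ 4 * ν.hDetect ∧
      (1 / 2) * ν.hLocalize m ≤ ν'.hLocalize m ∧ ν'.hLocalize m ≤ ν.hLocalize m ∧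
      δ ≤ (π.prob ν').real {ω | ENNReal.ofReal
          ((1 / 4) * ν.hDetect * Real.log (1 / (8 * δ))
            + (1 / 2) * ν.hLocalize m * Real.log (1 / (8 * δ))
            + (1 / 2) * ∑ i, 1 / ν.jump i ^ 2 * Real.posLog (ν.spacing i / (16 * η)))
        ≤ (π.budget ν' ω : ENNReal)} := by
  set L := Real.log (1 / (8 * δ)) with hL
  set T := ∑ i, 1 / ν.jump i ^ 2 * Real.posLog (ν.spacing i / (16 * η)) with hT
  set A := (1 / 4) * ν.hDetect * L + (1 / 2) * ν.hLocalize m * L + (1 / 2) * T with hA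
  by_contra hcon
  have hcon' : ∀ ν' : Environment m, Environment.Comparable ν ν' →
      (π.prob ν').real {ω | ENNReal.ofReal A ≤ (π.budget ν' ω : ENNReal)} < δ := by
    intro ν' h
    by_contra hle
    exact hcon ⟨ν', h.1, h.2, h.3, h.4, not_lt.1 hle⟩
  -- For `A ≤ 0` the event is certain, so its probability is not below `δ`.
  have hApos : 0 < A := by
    by_contra hA0
    have h1 := hcon' ν.compress (ν.comparable_perturb hm _ _ _)
    have : IsProbabilityMeasure (π.prob ν.compress) := by unfold Algorithm.prob; infer_instance
    rw [ENNReal.ofReal_of_nonpos (not_lt.1 hA0)] at h1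
    simp only [zero_le, Set.ofPred_true, probReal_univ] at h1
    linarith [hδ.2]
  -- The largest integer strictly below `A`: a budget not reaching `A` is at most `n`.
  set n := ⌈A⌉₊ - 1 with hn
  have hnA : (n : ℝ) < A := by
    have h1 : 1 ≤ ⌈A⌉₊ := Nat.one_le_ceil_iff.2 hApos
    rw [hn, Nat.cast_sub h1]
    have := Nat.ceil_lt_add_one hApos.le
    push_cast
    linarith
  have hnt : ∀ t : ℕ, (t : ℝ) < A → t ≤ n := by
    intro t ht
    have := Nat.lt_ceil.2 ht
    omega
  have hsolve : π.SolvesComparable ν δ η n := fun ν' hν' h =>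
    π.le_law_answerSet hπ ν' hν' hnt (hcon' ν' h)
  have hb := π.two_mul_sum_posLog_le hm hδ.2 hη.1 hsolve
  have hD0 := ν.hDetect_nonneg hm
  have hl0 := ν.hLocalize_nonneg
  have hn0 : (0 : ℝ) ≤ n := Nat.cast_nonneg n
  by_cases hδ8 : δ < 1 / 8
  · have hδ' : δ ∈ Set.Ioo (0 : ℝ) (1 / 8) := ⟨hδ.1, hδ8⟩
    have ha := π.two_mul_hLocalize_mul_log_le hδ' hη.2 hπ ν n
      (hsolve _ rfl (ν.comparable_perturb hm _ _ _))
    have hc := π.half_mul_hDetect_mul_log_le hm hδ' hη.2 hπ hsolve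
    -- `A ≤ n/2 + n/4 + n/4 = n < A`.
    linarith
  · have hL0 : L ≤ 0 := by
      refine Real.log_nonpos (by have := hδ.1; positivity) ?_
      rw [div_le_one (by linarith [hδ.1])]
      linarith [not_lt.1 hδ8]
    have h1 := mul_nonpos_of_nonneg_of_nonpos hD0 hL0
    have h2 := mul_nonpos_of_nonneg_of_nonpos hl0 hL0
    linarith
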